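/- All graphs are simple. For a finite graph $G$ let $v(G)$ be its number of vertices, $m_k(G)$ the number of its $k$-matchings, $\mathrm{prm}(G)$ the number of its perfect matchings and $\nu(G)$ the size of a largest matching; put $p^*(G)=2\nu(G)/v(G)$, $M(G,t)=\sum_k m_k(G)t^k$, and $\mu(G,x)=\sum_k(-1)^k m_k(G)x^{v(G)-2k}$. Let $\rho_G$ be the uniform distribution on the zeros (with multiplicity) of $\mu(G,x)$. If $v(G)=2n$ and $M(G,t)=\prod_{j=1}^n(1+\gamma_j(G)t)$, let $\overline\rho_G$ be the uniform distribution on $\gamma_1(G),\dots,\gamma_n(G)$. Let $$p(G,t)=\frac{t\,M'(G,t)}{\frac{v(G)}{2}\,M(G,t)},\qquad F(G,t)=\frac{\ln M(G,t)}{v(G)}-\frac12\,p(G,t)\ln t ,$$ let $t(G,\cdot):[0,p^*(G))\to[0,\infty)$ be the inverse function of $t\mapsto p(G,t)$, and let $\lambda_G(p)=F(G,t(G,p))$ for $0\le p<p^*(G)$, $\lambda_G(p^*(G))=\lim_{p\nearrow p^*(G)}\lambda_G(p)$, and $\lambda_G(p)=0$ for $p>p^*(G)$. For a finite rooted graph $\alpha$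 and $r\ge1$, let $\mathbb P(G,\alpha,r)$ be the probability that the $r$-ball around a uniformly random vertex of $G$ is isomorphic to $\alpha$ as a rooted graph; for a random rooted graph $L$ (a probability distribution on rooted graphs) let $\mathbb P(L,\alpha,r)$ be the probability that the $r$-ball around the root is isomorphic to $\alpha$. A sequence $(G_i)$ of non-empty finite graphs of bounded degree is Benjamini--Schramm convergent if $\mathbb P(G_i,\alpha,r)$ converges for all $\alpha$ and $r$, and it converges to $L$ if $\mathbb P(G_i,\alpha,r)\to\mathbb P(L,\alpha,r)$ for all $\alpha$ and $r$. If $L$ is the limit of some sequence of such graphs with $p^*=1$, let $\lambda_L(p)=\lim_i\lambda_{H_i}(p)$ for $0\le p<1$, where $(H_i)$ is any sequence converging to $L$ with $p^*(H_i)=1$ for all $i$, and $\lambda_L(1)=\lim_{p\nearrow1}\lambda_L(p)$. **Theorem.** Let $d\ge1$ and let $(G_i)$ be a Benjamini--Schramm convergent sequence of non-empty finite vertex-transitive bipartite $d$-regular graphs. Then $\mathrm{prm}(G_i)>0$ and $\lambda_{G_i}(1)=\frac{\ln\mathrm{prm}(G_i)}{v(G_i)}$ for every $i$. The measures $\rho_{G_i}$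 and $\overline\rho_{G_i}$ converge weakly to probability measures $\rho$ and $\overline\rho$, where $\overline\rho$ is the image of $\rho$ under $z\mapsto z^2$; one has $\overline\rho(\{0\})=0$, the function $\ln$ is $\overline\rho$-integrable, and the sequence $\frac{\ln\mathrm{prm}(G_i)}{v(G_i)}$ is convergent, with $$\lim_{i\to\infty}\frac{\ln\mathrm{prm}(G_i)}{v(G_i)}=\frac12\int\ln(x)\,d\overline\rho(x).$$ Furthermore, if $(G_i)$ Benjamini--Schramm converges to a random rooted graph $L$, then $\lambda_L$ is well defined on $[0,1]$ (the above limits exist and do not depend on the choice of $(H_i)$), and $$\lim_{i\to\infty}\lambda_{G_i}(1)=\lambda_L(1)=\frac12\int\ln(x)\,d\overline\rho(x).$$ -/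

import Mathlib

open MeasureTheory Filter Topology Polynomial
open scoped ENNReal BoundedContinuousFunction

noncomputable section

namespace MatchEnt

/-! ## Rooted graphs, balls and Benjamini–Schramm convergence -/

/-- A (finite or infinite, simple) graph with a distinguished root. -/
structure RootedGraph where
  /-- the vertices -/
  V : Type
  /-- the graph -/
  graph : SimpleGraph V
  /-- the root -/
  root : V

/-- The ball of radius `r` around `v` in `G`, with the induced graph structure and rooted
at `v`, is isomorphic to `α` as a rooted graph. -/
def BallIso {V : Type} (G : SimpleGraph V) (v : V) (r : ℕ) (α : RootedGraph) : Prop :=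
  ∃ e : G.induce {w : V | G.edist v w ≤ (r : ℕ∞)} ≃g α.graph,
    e ⟨v, by simp⟩ = α.root

/-- The set of rooted graphs whose `r`-ball around the root is isomorphic to `α`. -/
def ballEvent (r : ℕ) (α : RootedGraph) : Set RootedGraph :=
  {x | BallIso x.graph x.root r α}

/-- The σ-algebra generated by the events "the `r`-ball around the root is isomorphic to `α`"
for `r > 0` and finite `α`. It does not separate isomorphic rooted graphs, so
that a measure on it is a measure on isomorphism classes. -/
instance : MeasurableSpace RootedGraph :=
  MeasurableSpace.generateFrom
    {S | ∃ (r : ℕ) (α : RootedGraph), 0 < r ∧ Finite α.V ∧ S = ballEvent r α}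

/-- `ℙ(L, α, r)` for a random rooted graph `L`, i.e. a probability measure `L` on rooted
graphs. -/
def ballProbLimit (L : Measure RootedGraph) (α : RootedGraph) (r : ℕ) : ℝ :=
  L.real (ballEvent r α)

/-- `ℙ(G, α, r)`: the probability that the `r`-ball around a uniformly random vertex of the
finite graph `G` is isomorphic to `α`. -/
def ballProb {V : Type} (G : SimpleGraph V) (α : RootedGraph) (r : ℕ) : ℝ :=
  ({v : V | BallIso G v r α}.ncard : ℝ) / (Nat.card V : ℝ)

/-- All degrees in all graphs of the sequence are at most one constant. -/
def BoundedDegree {V : ℕ → Type} (G : ∀ i, SimpleGraph (V i)) : Prop :=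
  ∃ D : ℕ, ∀ i (v : V i), ((G i).neighborSet v).ncard ≤ D

/-- Benjamini–Schramm convergence of a sequence of finite graphs of bounded degree. -/
def BSConvergent {V : ℕ → Type} (G : ∀ i, SimpleGraph (V i)) : Prop :=
  BoundedDegree G ∧
    ∀ (α : RootedGraph) (r : ℕ), Finite α.V → 0 < r →
      ∃ c : ℝ, Tendsto (fun i => ballProb (G i) α r) atTop (𝓝 c)

/-- Benjamini–Schramm convergence of a sequence of finite graphs of bounded degree to the
random rooted graph `L`. -/
def BSConvergesTo {V : ℕ → Type} (G : ∀ i, SimpleGraph (V i)) (L : Measure RootedGraph) :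
    Prop :=
  BoundedDegree G ∧
    ∀ (α : RootedGraph) (r : ℕ), Finite α.V → 0 < r →
      Tendsto (fun i => ballProb (G i) α r) atTop (𝓝 (ballProbLimit L α r))

/-- Every vertex can be moved to every other vertex by an automorphism. -/
def VertexTransitive {V : Type} (G : SimpleGraph V) : Prop :=
  ∀ u v : V, ∃ φ : G ≃g G, φ u = v

/-! ## Matchings -/

/-- `m_k(G)`: the number of `k`-matchings of `G`. -/
def numMatchings {V : Type} (G : SimpleGraph V) (k : ℕ) : ℕ :=
  {M : G.Subgraph | M.IsMatching ∧ M.edgeSet.ncard = k}.ncard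

/-- `prm(G)`: the number of perfect matchings of `G`. -/
def prm {V : Type} (G : SimpleGraph V) : ℕ :=
  {M : G.Subgraph | M.IsPerfectMatching}.ncard

/-- `ν(G)`: the number of edges of a largest matching of `G`. -/
def matchingNumber {V : Type} (G : SimpleGraph V) : ℕ :=
  sSup {k | ∃ M : G.Subgraph, M.IsMatching ∧ M.edgeSet.ncard = k}

/-- The matching generating function `M(G,t) = ∑ m_k(G) t^k`. -/
def genPoly {V : Type} (G : SimpleGraph V) : ℝ[X] :=
  ∑ k ∈ Finset.range (Nat.card V / 2 + 1), C (numMatchings G k : ℝ) * X ^ k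

/-- The matching polynomial `μ(G,x) = ∑ (-1)^k m_k(G) x^(v(G)-2k)`. -/
def matchingPoly {V : Type} (G : SimpleGraph V) : ℝ[X] :=
  ∑ k ∈ Finset.range (Nat.card V / 2 + 1),
    C ((-1) ^ k * (numMatchings G k : ℝ)) * X ^ (Nat.card V - 2 * k)

/-- The matching measure `ρ_G`: the uniform distribution on the zeros of `μ(G,x)`, with
multiplicity (all of these zeros are real). -/
def matchingMeasure {V : Type} (G : SimpleGraph V) : Measure ℝ :=
  ((Nat.card V : ℝ≥0∞)⁻¹) • ((matchingPoly G).roots.map (fun z => Measure.dirac z)).sum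

/-- The numbers `γ_1(G), …, γ_n(G)` with `M(G,t) = ∏ (1 + γ_j(G) t)`, where `v(G) = 2n`, that
is, the roots with multiplicity of `x^n M(G,-1/x) = ∑ (-1)^k m_k(G) x^(n-k) = ∏ (x - γ_j(G))`
(all of them are real). -/
def gammas {V : Type} (G : SimpleGraph V) : Multiset ℝ :=
  (∑ k ∈ Finset.range (Nat.card V / 2 + 1),
    C ((-1) ^ k * (numMatchings G k : ℝ)) * X ^ (Nat.card V / 2 - k) : ℝ[X]).roots

/-- The uniform distribution on `γ_1(G), …, γ_n(G)`, where `v(G) = 2n`. -/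
def gammaMeasure {V : Type} (G : SimpleGraph V) : Measure ℝ :=
  (((Nat.card V / 2 : ℕ) : ℝ≥0∞)⁻¹) • ((gammas G).map (fun z => Measure.dirac z)).sum

/-- Weak convergence of measures on the real line. -/
def WeakConv (ρ : ℕ → Measure ℝ) (ρ' : Measure ℝ) : Prop :=
  ∀ f : ℝ →ᵇ ℝ, Tendsto (fun i => ∫ x, f x ∂(ρ i)) atTop (𝓝 (∫ x, f x ∂ρ'))

/-! ## The entropy function -/

/-- The density function `p(G,t) = t M'(G,t) / (n M(G,t))`, where `v(G) = 2n`. -/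
def density {V : Type} (G : SimpleGraph V) (t : ℝ) : ℝ :=
  t * (derivative (genPoly G)).eval t / ((Nat.card V : ℝ) / 2 * (genPoly G).eval t)

/-- `F(G,t) = ln M(G,t) / v(G) - p(G,t) ln(t) / 2`. -/
def freeEnergy {V : Type} (G : SimpleGraph V) (t : ℝ) : ℝ :=
  Real.log ((genPoly G).eval t) / (Nat.card V : ℝ) - 1 / 2 * density G t * Real.log t

/-- `p*(G) = 2 ν(G) / v(G)`. -/
def pStar {V : Type} (G : SimpleGraph V) : ℝ :=
  2 * (matchingNumber G : ℝ) / (Nat.card V : ℝ)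

/-- `t(G,p)`: the inverse of the strictly increasing bijection
`t ↦ p(G,t)` from `[0,∞)` to `[0,p*(G))`. -/
def activity {V : Type} (G : SimpleGraph V) (p : ℝ) : ℝ :=
  Function.invFunOn (density G) (Set.Ici 0) p

/-- The entropy function `λ_G(p)`: equal to `F(G,t(G,p))` for `p < p*(G)`, to the limit from
the left at `p = p*(G)`, and to `0` for `p > p*(G)`. -/
def entropy {V : Type} (G : SimpleGraph V) (p : ℝ) : ℝ :=
  open Classical in
  if p < pStar G then freeEnergy G (activity G p)
  else if p = pStar G then
    limUnder (𝓝[<] (pStar G)) (fun q => freeEnergy G (activity G q))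
  else 0

/-- The sequence of non-empty finite graphs `H`, of bounded degree and with `p*(H_i) ≥ p₀` for
all `i`, Benjamini–Schramm converges to the random rooted graph `L`. -/
structure Approximates {W : ℕ → Type} (H : ∀ i, SimpleGraph (W i)) (L : Measure RootedGraph)
    (p₀ : ℝ) : Prop where
  finite : ∀ i, Finite (W i)
  nonempty : ∀ i, Nonempty (W i)
  converges : BSConvergesTo H L
  le_pStar : ∀ i, p₀ ≤ pStar (H i)

/-- `lam` is the entropy function `λ_L` of the random rooted graph `L` on `[0,p₀]`: the random
rooted graph `L` is the limit of some sequence of graphs with `p* ≥ p₀`; one has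
`λ_L(p) = lim λ_{H_i}(p)` for `0 ≤ p < p₀`, whatever such sequence `(H_i)` is taken; and
`λ_L(p₀)` is the limit of `λ_L(p)` as `p` tends to `p₀` from the left. (These conditions
determine `lam` on `[0,p₀]` if `p₀ > 0`.) -/
structure IsEntropyOf (L : Measure RootedGraph) (p₀ : ℝ) (lam : ℝ → ℝ) : Prop where
  exists_approx : ∃ (W : ℕ → Type) (H : ∀ i, SimpleGraph (W i)), Approximates H L p₀
  tendsto : ∀ (W : ℕ → Type) (H : ∀ i, SimpleGraph (W i)), Approximates H L p₀ →
    ∀ p : ℝ, 0 ≤ p → p < p₀ → Tendsto (fun i => entropy (H i) p) atTop (𝓝 (lam p))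
  left_limit : Tendsto lam (𝓝[<] p₀) (𝓝 (lam p₀))

end MatchEnt

end

/-!
Everything about matchings is derived from one recurrence, `matchSum_rec`: for a finite set `S` of
vertices and `u ∈ S`, the generating function `W(S)` of the matchings inside `S` satisfies
`W(S) = W(S \ u) + t ∑ W(S \ {u, v})`, where `v` runs over the neighbours of `u` in `S`.

*Real roots.* For `Re s > 0` and `t = s²` the recurrence is a continued fraction for the ratios
`s W(S \ u) / W(S)`, which keeps them in the right half-plane (`matchSum_sq_ne_zero`); so the `γ_j`
are real and nonnegative. For small negative `t` it also shows that they are bounded in terms of the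
maximal degree (`matchSum_pos_of_small`). Hence the root measures `ν` live on a compact interval
`[0,K]`, and `p(G,t) = ∫ x t / (1 + x t) dν(x)`.

*Locality.* `1 - p(G,t)` is the average over the vertices `u` of the probability `W(V \ u) / W(V)`
that `u` is uncovered by a random matching. For small `t` the recurrence contracts, so that this
probability is determined by a ball around `u` up to a small error, and `p(G,t)` is asymptotically a
function of the ball frequencies (`tendsto_density_sub`). The values of `p(G,t)` for small `t`
determine the moments of `ν` (`AsympEq.of_density`). Therefore Benjamini–Schramm convergence implies
weak convergence of the root measures.

*Tightness near zero.* In a bipartite graph, `W(S \ u) W(S \ v) ≤ W(S) W(S \ {u, v})` if `u` and `v`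
lie on different sides (`matchSum_correlation`). In a vertex-transitive graph all vertices are
uncovered with the same probability `a = 1 - p(G,t)`. For an edge `uv` the inequality bounds the
probability that both of its ends are uncovered from below by `a²`, whereas adding the edge `uv`
to the matching bounds it from above by `1 / t`. So `1 - p(G,t) ≤ 1 / √t`, uniformly in `G`
(`one_sub_density_le`). This forces perfect matchings to exist, and it gives
`∫ ln (x + s) dν - ∫ ln x dν ≤ 3 √s` (`integral_log_add_le`), so that the logarithm is integrable
uniformly along the sequence. As `ln prm(G) / v(G) = 1/2 ∫ ln x dν`, the convergence follows.

*Entropy.* For `p < 1` the entropy is a continuous function of `ν` as long as the limit measure has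
no atom at zero, by convergence of the inverse functions of the densities (`tendsto_measEnergy`);
the estimate `(1 - p(t)) ln t ≤ ln t / √t` identifies its limit at `p = 1`
(`tendsto_measEnergy_atTop`).
-/

noncomputable section

namespace MatchEnt

open scoped Classical

/-! ### Matching sums and their recurrence -/

section MatchSum

variable {V : Type*} {R : Type*} [CommSemiring R]

/-- The matchings of `G` all of whose edges lie inside the finite set `S` of vertices. A matching
is encoded by its set of edges, which are pairwise disjoint. -/
def matchingsIn (G : SimpleGraph V) (S : Finset V) : Finset (Finset (Sym2 V)) :=
  S.sym2.powerset.filter fun E =>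
    (∀ e ∈ E, e ∈ G.edgeSet) ∧ ∀ e ∈ E, ∀ f ∈ E, ∀ v, v ∈ e → v ∈ f → e = f

lemma mem_matchingsIn {G : SimpleGraph V} {S : Finset V} {E : Finset (Sym2 V)} :
    E ∈ matchingsIn G S ↔ (∀ e ∈ E, ∀ v ∈ e, v ∈ S) ∧ (∀ e ∈ E, e ∈ G.edgeSet) ∧
      ∀ e ∈ E, ∀ f ∈ E, ∀ v, v ∈ e → v ∈ f → e = f := by
  simp only [matchingsIn, Finset.mem_filter, Finset.mem_powerset, Finset.subset_iff,
    Finset.mem_sym2_iff]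

/-- The matching generating function of the subgraph of `G` induced on `S`, evaluated at `t`. -/
def matchSum (G : SimpleGraph V) (S : Finset V) (t : R) : R :=
  ∑ E ∈ matchingsIn G S, t ^ E.card

lemma matchSum_empty (G : SimpleGraph V) (t : R) : matchSum G ∅ t = 1 := by
  have : matchingsIn G ∅ = {∅} := by
    ext E
    simp only [mem_matchingsIn, Finset.mem_singleton]
    constructor
    · rintro ⟨h, -⟩
      refine Finset.eq_empty_of_forall_notMem fun e he => ?_
      induction e with | _ a b => simpa using h _ he a (by simp)
    · rintro rfl; simp
  simp [matchSum, this]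

lemma matchingsIn_erase (G : SimpleGraph V) (S : Finset V) (u : V) :
    matchingsIn G (S.erase u) = (matchingsIn G S).filter fun E => ∀ e ∈ E, u ∉ e := by
  ext E
  simp only [mem_matchingsIn, Finset.mem_filter, Finset.mem_erase]
  constructor
  · rintro ⟨h1, h2⟩
    exact ⟨⟨fun e he v hv => (h1 e he v hv).2, h2⟩, fun e he hu => (h1 e he u hu).1 rfl⟩
  · rintro ⟨⟨h1, h2⟩, h3⟩
    refine ⟨fun e he v hv => ⟨?_, h1 e he v hv⟩, h2⟩
    rintro rfl
    exact h3 e he hv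

/-- The basic recurrence: a matching either misses `u`, or matches `u` to one of its neighbours. -/
lemma matchSum_rec (G : SimpleGraph V) {S : Finset V} {u : V} (hu : u ∈ S) (t : R) :
    matchSum G S t = matchSum G (S.erase u) t +
      t * ∑ v ∈ S.filter (G.Adj u), matchSum G ((S.erase u).erase v) t := by
  rw [matchSum, ← Finset.sum_filter_add_sum_filter_not _ (fun E => ∀ e ∈ E, u ∉ e),
    ← matchingsIn_erase]
  congr 1
  simp only [matchSum, Finset.mul_sum]
  rw [Finset.sum_sigma']
  symm
  have key : ∀ a : (_ : V) × Finset (Sym2 V), a ∈ (S.filter (G.Adj u)).sigma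
      (fun v => matchingsIn G ((S.erase u).erase v)) → ∀ e ∈ a.2, u ∉ e ∧ a.1 ∉ e := by
    rintro ⟨v, E⟩ h e he
    simp only [Finset.mem_sigma, mem_matchingsIn, Finset.mem_erase] at h
    exact ⟨fun hh => (h.2.1 e he _ hh).2.1 rfl, fun hh => (h.2.1 e he _ hh).1 rfl⟩
  refine Finset.sum_bij (fun a _ => insert s(u, a.1) a.2) ?_ ?_ ?_ ?_
  · rintro ⟨v, E⟩ h
    have hk := key _ h
    simp only [Finset.mem_sigma, Finset.mem_filter, mem_matchingsIn, Finset.mem_erase] at h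
    obtain ⟨⟨hv, huv⟩, h1, h2, h3⟩ := h
    simp only [Finset.mem_filter, mem_matchingsIn, Finset.mem_insert, forall_eq_or_imp,
      SimpleGraph.mem_edgeSet, not_and, Sym2.mem_iff]
    refine ⟨⟨⟨⟨hu, by rintro w rfl; exact hv⟩, fun e he w hw => (h1 e he w hw).2.2⟩,
      ⟨huv, h2⟩, ⟨by simp, ?_⟩, ?_⟩, by simp⟩
    · refine fun f hf => ⟨fun hw => absurd hw (hk f hf).1, ?_⟩
      rintro w rfl hw
      exact absurd hw (hk f hf).2
    · refine fun e he => ⟨?_, h3 e he⟩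
      rintro w hw (rfl | rfl)
      · exact absurd hw (hk e he).1
      · exact absurd hw (hk e he).2
  · rintro ⟨v, E⟩ h ⟨v', E'⟩ h' heq
    have hk := key _ h
    have hk' := key _ h'
    have hvv : v = v' := by
      have : s(u, v) ∈ insert s(u, v') E' := heq ▸ Finset.mem_insert_self _ _
      rcases Finset.mem_insert.1 this with h1 | h1
      · exact Sym2.congr_right.1 h1
      · exact absurd (by simp) (hk' _ h1).1
    subst hvv
    have : E = E' := by
      have h1 : s(u, v) ∉ E := fun hh => (hk _ hh).1 (by simp)
      have h2 : s(u, v) ∉ E' := fun hh => (hk' _ hh).1 (by simp)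
      rw [← Finset.erase_insert h1, ← Finset.erase_insert h2]
      exact congrArg (fun F => Finset.erase F s(u, v)) heq
    rw [this]
  · intro E hE
    simp only [Finset.mem_filter, mem_matchingsIn, not_forall, not_not] at hE
    obtain ⟨⟨h1, h2, h3⟩, e, he, hue⟩ := hE
    obtain ⟨v, rfl⟩ := hue
    refine ⟨⟨v, E.erase s(u, v)⟩, ?_, Finset.insert_erase he⟩
    simp only [Finset.mem_sigma, Finset.mem_filter, mem_matchingsIn, Finset.mem_erase]
    refine ⟨⟨h1 _ he v (by simp), h2 _ he⟩, ?_, fun e he => h2 e he.2,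
      fun e he f hf => h3 e he.2 f hf.2⟩
    rintro f ⟨hne, hf⟩ w hw
    refine ⟨?_, ?_, h1 _ hf w hw⟩
    · rintro rfl; exact hne (h3 _ hf _ he w hw (by simp))
    · rintro rfl; exact hne (h3 _ hf _ he w hw (by simp))
  · rintro ⟨v, E⟩ h
    have hk := key _ h
    dsimp only
    rw [Finset.card_insert_of_notMem (fun hh => (hk _ hh).1 (by simp)), pow_succ']

/-- Matching sums are preserved by embeddings of induced subgraphs. -/
lemma matchSum_map {V' : Type*} {G : SimpleGraph V} {G' : SimpleGraph V'} (f : V ↪ V')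
    (S : Finset V) (hf : ∀ a ∈ S, ∀ b ∈ S, G'.Adj (f a) (f b) ↔ G.Adj a b) (t : R) :
    matchSum G' (S.map f) t = matchSum G S t := by
  induction S using Finset.strongInduction with
  | _ S ih =>
  rcases S.eq_empty_or_nonempty with rfl | ⟨u, hu⟩
  · simp [matchSum_empty]
  · have hsub : ∀ T ⊂ S, matchSum G' (T.map f) t = matchSum G T t := fun T hT =>
      ih T hT fun a ha b hb => hf a (hT.1 ha) b (hT.1 hb)
    rw [matchSum_rec G hu, matchSum_rec G' (Finset.mem_map_of_mem f hu)]
    have hfil : (S.map f).filter (G'.Adj (f u)) = (S.filter (G.Adj u)).map f := by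
      ext w
      simp only [Finset.mem_filter, Finset.mem_map]
      constructor
      · rintro ⟨⟨a, ha, rfl⟩, h⟩
        exact ⟨a, ⟨ha, (hf u hu a ha).1 h⟩, rfl⟩
      · rintro ⟨a, ⟨ha, h⟩, rfl⟩
        exact ⟨⟨a, ha, rfl⟩, (hf u hu a ha).2 h⟩
    rw [hfil, Finset.sum_map, ← Finset.map_erase, hsub _ (Finset.erase_ssubset hu)]
    congr 2
    refine Finset.sum_congr rfl fun v hv => ?_
    rw [← Finset.map_erase, hsub]
    exact (Finset.erase_subset _ _).trans_ssubset (Finset.erase_ssubset hu)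

/-- A matching covers twice as many vertices as it has edges. -/
lemma card_uncovered_add {G : SimpleGraph V} {S : Finset V} {E : Finset (Sym2 V)}
    (hE : E ∈ matchingsIn G S) :
    (S.filter fun u => ∀ e ∈ E, u ∉ e).card + 2 * E.card = S.card := by
  obtain ⟨h1, h2, h3⟩ := mem_matchingsIn.1 hE
  rw [← Finset.card_filter_add_card_filter_not (s := S) (fun u => ∀ e ∈ E, u ∉ e)]
  congr 1
  have : (S.filter fun u => ¬ ∀ e ∈ E, u ∉ e) = E.biUnion fun e => S.filter (· ∈ e) := by
    ext u
    simp only [not_forall, not_not, Finset.mem_filter, Finset.mem_biUnion]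
    grind
  rw [this, Finset.card_biUnion, Finset.sum_const_nat (m := 2), mul_comm]
  · intro e he
    have hs := h1 e he
    have hd := h2 e he
    induction e with | _ a b =>
    have : S.filter (· ∈ s(a, b)) = {a, b} := by
      ext w
      simp only [Finset.mem_filter, Sym2.mem_iff, Finset.mem_insert, Finset.mem_singleton]
      constructor
      · exact fun h => h.2
      · exact fun h => ⟨hs w (by simpa using h), h⟩
    rw [this, Finset.card_pair]
    exact G.ne_of_adj hd
  · intro e he f hf hne
    rw [Function.onFun, Finset.disjoint_left]
    intro u hu hu'
    exact hne (h3 e he f hf u (Finset.mem_filter.1 hu).2 (Finset.mem_filter.1 hu').2)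

lemma sum_matchSum_erase (G : SimpleGraph V) (S : Finset V) (t : ℝ) :
    ∑ u ∈ S, matchSum G (S.erase u) t =
      ∑ E ∈ matchingsIn G S, ((S.card : ℝ) - 2 * (E.card : ℝ)) * t ^ E.card := by
  simp only [matchSum, matchingsIn_erase, Finset.sum_filter]
  rw [Finset.sum_comm]
  refine Finset.sum_congr rfl fun E hE => ?_
  rw [← Finset.sum_filter, Finset.sum_const, nsmul_eq_mul, ← card_uncovered_add hE]
  push_cast
  ring

end MatchSum

section NumMatchings

variable {V : Type} [Fintype V]

lemma edgeSet_mem_matchingsIn {G : SimpleGraph V} {M : G.Subgraph} (hM : M.IsMatching) :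
    M.edgeSet.toFinset ∈ matchingsIn G Finset.univ := by
  simp only [mem_matchingsIn, Set.mem_toFinset, Finset.mem_univ, implies_true, true_and]
  refine ⟨fun e he => M.edgeSet_subset he, ?_⟩
  rintro e he f hf v ⟨a, rfl⟩ ⟨b, rfl⟩
  exact Sym2.congr_right.2 (hM.eq_of_adj_left he hf)

lemma numMatchings_eq_card (G : SimpleGraph V) (k : ℕ) :
    numMatchings G k = ((matchingsIn G Finset.univ).filter fun E => E.card = k).card := by
  rw [numMatchings, ← Set.ncard_coe_finset]
  refine Set.ncard_congr (fun M _ => M.edgeSet.toFinset) ?_ ?_ ?_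
  · rintro M ⟨hM, hk⟩
    rw [Finset.mem_coe, Finset.mem_filter, ← hk, Set.ncard_eq_toFinset_card']
    exact ⟨edgeSet_mem_matchingsIn hM, rfl⟩
  · rintro M M' ⟨hM, -⟩ ⟨hM', -⟩ h
    exact SimpleGraph.Subgraph.IsMatching.injOn_edgeSet hM hM' (Set.toFinset_inj.1 h)
  · intro E hE
    simp only [Finset.coe_filter, Set.mem_ofPred_eq, mem_matchingsIn] at hE
    obtain ⟨⟨-, h2, h3⟩, hk⟩ := hE
    let M : G.Subgraph :=
      { verts := {v | ∃ e ∈ E, v ∈ e}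
        Adj := fun a b => s(a, b) ∈ E
        adj_sub := fun h => h2 _ h
        edge_vert := fun h => ⟨_, h, by simp⟩
        symm := ⟨fun a b h => by rwa [Sym2.eq_swap]⟩ }
    have hMe : M.edgeSet = (E : Set (Sym2 V)) := by
      ext e
      induction e with | _ a b => exact Iff.rfl
    refine ⟨M, ⟨?_, by rw [hMe, Set.ncard_coe_finset, hk]⟩, by simp [hMe]⟩
    rintro v ⟨e, he, ⟨w, rfl⟩⟩
    refine ⟨w, he, fun w' hw' => ?_⟩
    exact Sym2.congr_right.1 (h3 _ hw' _ he v (by simp) (by simp))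

lemma two_mul_card_le {G : SimpleGraph V} {E : Finset (Sym2 V)}
    (hE : E ∈ matchingsIn G Finset.univ) : 2 * E.card ≤ Nat.card V := by
  have := card_uncovered_add hE
  rw [Finset.card_univ] at this
  rw [Nat.card_eq_fintype_card]
  omega

lemma sum_numMatchings {R : Type*} [CommSemiring R] (G : SimpleGraph V) (g : ℕ → R) :
    ∑ k ∈ Finset.range (Nat.card V / 2 + 1), (numMatchings G k : R) * g k =
      ∑ E ∈ matchingsIn G Finset.univ, g E.card := by
  rw [← Finset.sum_fiberwise_of_maps_to (s := matchingsIn G Finset.univ) (g := Finset.card)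
    (t := Finset.range (Nat.card V / 2 + 1))]
  · refine Finset.sum_congr rfl fun k _ => ?_
    rw [numMatchings_eq_card, ← nsmul_eq_mul, ← Finset.sum_const]
    exact Finset.sum_congr rfl fun E hE => by rw [(Finset.mem_filter.1 hE).2]
  · intro E hE
    have := two_mul_card_le hE
    rw [Finset.mem_range]
    omega

lemma eval_genPoly (G : SimpleGraph V) (t : ℝ) :
    (genPoly G).eval t = matchSum G Finset.univ t := by
  rw [matchSum, ← sum_numMatchings G fun k => t ^ k, genPoly, eval_finsetSum]
  simp

lemma mul_eval_derivative_genPoly (G : SimpleGraph V) (t : ℝ) :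
    t * (derivative (genPoly G)).eval t =
      ∑ E ∈ matchingsIn G Finset.univ, (E.card : ℝ) * t ^ E.card := by
  rw [← sum_numMatchings G fun k => (k : ℝ) * t ^ k, genPoly, derivative_sum, eval_finsetSum,
    Finset.mul_sum]
  refine Finset.sum_congr rfl fun k _ => ?_
  rcases k with _ | k
  · simp
  · simp only [derivative_mul, derivative_C, derivative_X_pow, eval_add, eval_mul, eval_C,
      eval_pow, eval_X, eval_zero, Nat.add_sub_cancel]
    ring

/-- The vertex deleted sums average to the expected proportion of uncovered vertices. -/
lemma sum_matchSum_univ_erase (G : SimpleGraph V) (t : ℝ) :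
    ∑ u, matchSum G (Finset.univ.erase u) t =
      Nat.card V * (genPoly G).eval t - 2 * (t * (derivative (genPoly G)).eval t) := by
  rw [sum_matchSum_erase, mul_eval_derivative_genPoly, eval_genPoly, matchSum, Finset.mul_sum,
    Finset.mul_sum, ← Finset.sum_sub_distrib, Nat.card_eq_fintype_card, Finset.card_univ]
  exact Finset.sum_congr rfl fun E _ => by ring

lemma numMatchings_zero (G : SimpleGraph V) : numMatchings G 0 = 1 := by
  rw [numMatchings_eq_card, Finset.card_eq_one]
  refine ⟨∅, ?_⟩
  ext E
  simp only [Finset.mem_filter, mem_matchingsIn, Finset.card_eq_zero, Finset.mem_singleton]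
  constructor
  · exact fun h => h.2
  · rintro rfl; simp

lemma numMatchings_eq_zero {G : SimpleGraph V} {k : ℕ} (hk : Nat.card V < 2 * k) :
    numMatchings G k = 0 := by
  rw [numMatchings_eq_card, Finset.card_eq_zero, Finset.filter_eq_empty_iff]
  rintro E hE rfl
  exact absurd (two_mul_card_le hE) (by omega)

end NumMatchings

/-! ### Inequalities for matching sums -/

section Inequalities

variable {V : Type*}

lemma one_le_matchSum (G : SimpleGraph V) (S : Finset V) {t : ℝ} (ht : 0 ≤ t) :
    1 ≤ matchSum G S t := by
  have : ∅ ∈ matchingsIn G S := by simp [mem_matchingsIn]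
  calc (1 : ℝ) = t ^ (∅ : Finset (Sym2 V)).card := by simp
    _ ≤ _ := Finset.single_le_sum (f := fun E : Finset (Sym2 V) => t ^ E.card)
      (fun E _ => by positivity) this

lemma matchSum_pos (G : SimpleGraph V) (S : Finset V) {t : ℝ} (ht : 0 ≤ t) :
    0 < matchSum G S t :=
  zero_lt_one.trans_le (one_le_matchSum G S ht)

/-- In a bipartite graph, the events that `u` and that `v` are uncovered by a random matching
are positively correlated if `u` and `v` lie on different sides, and negatively correlated if
they lie on the same side. Expanding at `u` reduces either case to the other one. -/
lemma matchSum_correlation {G : SimpleGraph V} (c : G.Coloring (Fin 2)) {t : ℝ} (ht : 0 ≤ t)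
    (S : Finset V) : ∀ u ∈ S, ∀ v ∈ S, u ≠ v →
      (c u ≠ c v → matchSum G (S.erase u) t * matchSum G (S.erase v) t ≤
        matchSum G S t * matchSum G ((S.erase u).erase v) t) ∧
      (c u = c v → matchSum G S t * matchSum G ((S.erase u).erase v) t ≤
        matchSum G (S.erase u) t * matchSum G (S.erase v) t) := by
  induction S using Finset.strongInduction with
  | _ S ih =>
  intro u hu v hv huv
  have hvS' : v ∈ S.erase u := Finset.mem_erase.2 ⟨huv.symm, hv⟩
  have hW := matchSum_rec G hu t
  have hWv := matchSum_rec G (Finset.mem_erase.2 ⟨huv, hu⟩ : u ∈ S.erase v) t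
  rw [Finset.erase_right_comm (a := v) (b := u)] at hWv
  rw [Finset.filter_erase] at hWv
  have hpos : ∀ T : Finset V, 0 ≤ matchSum G T t := fun T => (matchSum_pos G T ht).le
  set N := S.filter (G.Adj u) with hN
  have hstep : ∀ w ∈ N, w ≠ v → w ∈ S.erase u ∧ c w ≠ c u := by
    intro w hw _
    obtain ⟨hwS, hadj⟩ := Finset.mem_filter.1 hw
    exact ⟨Finset.mem_erase.2 ⟨(G.ne_of_adj hadj).symm, hwS⟩, (c.valid hadj).symm⟩
  rw [hW, hWv, add_mul, mul_add]
  refine ⟨fun hc => ?_, fun hc => ?_⟩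
  · rw [mul_comm (matchSum G (S.erase u) t) (matchSum G ((S.erase u).erase v) t)]
    refine add_le_add_right ?_ _
    rw [mul_assoc, mul_left_comm]
    refine mul_le_mul_of_nonneg_left ?_ ht
    rw [Finset.mul_sum, Finset.sum_mul]
    refine (Finset.sum_le_sum fun w hw => ?_).trans (Finset.sum_le_sum_of_subset_of_nonneg
      (Finset.erase_subset v N) fun w _ _ => mul_nonneg (hpos _) (hpos _))
    obtain ⟨hwv, hwN⟩ := Finset.mem_erase.1 hw
    obtain ⟨hw1, hw2⟩ := hstep w hwN hwv
    have hcw : c w = c v := by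
      generalize c w = a at *; generalize c u = b at *; generalize c v = d at *; omega
    have := (ih _ (Finset.erase_ssubset hu) w hw1 v hvS' hwv).2 hcw
    rwa [Finset.erase_right_comm (s := S.erase u) (a := w) (b := v)] at this
  · rw [mul_comm (matchSum G (S.erase u) t) (matchSum G ((S.erase u).erase v) t)]
    refine add_le_add_right ?_ _
    rw [mul_assoc, mul_left_comm (matchSum G (S.erase u) t)]
    refine mul_le_mul_of_nonneg_left ?_ ht
    have hvN : v ∉ N := fun h => c.valid (Finset.mem_filter.1 h).2 hc
    rw [Finset.erase_eq_of_notMem hvN, Finset.mul_sum, Finset.sum_mul]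
    refine Finset.sum_le_sum fun w hw => ?_
    have hwv : w ≠ v := fun h => hvN (h ▸ hw)
    obtain ⟨hw1, hw2⟩ := hstep w hw hwv
    have := (ih _ (Finset.erase_ssubset hu) w hw1 v hvS' hwv).1 (hc ▸ hw2)
    rwa [Finset.erase_right_comm (s := S.erase u) (a := w) (b := v)] at this

/-- The **Heilmann–Lieb theorem**: matching sums do not vanish at the squares of complex numbers
with positive real part. The ratios `s W(S \ u) / W(S)` stay in the right half-plane, by the
continued fraction that the recurrence gives for them. -/
lemma matchSum_sq_ne_zero (G : SimpleGraph V) {s : ℂ} (hs : 0 < s.re) (S : Finset V) :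
    matchSum G S (s ^ 2) ≠ 0 ∧
      ∀ u ∈ S, 0 < (s * matchSum G (S.erase u) (s ^ 2) / matchSum G S (s ^ 2)).re := by
  have hs0 : s ≠ 0 := by rintro rfl; simp at hs
  have hinv : ∀ z : ℂ, 0 < z.re → 0 < (z⁻¹).re := by
    intro z hz
    rw [Complex.inv_re]
    exact div_pos hz (Complex.normSq_pos.2 (by rintro rfl; simp at hz))
  induction S using Finset.strongInduction with
  | _ S ih =>
  have main : ∀ u ∈ S,
      0 < (matchSum G S (s ^ 2) / (s * matchSum G (S.erase u) (s ^ 2))).re := by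
    intro u hu
    obtain ⟨h0, h1⟩ := ih _ (Finset.erase_ssubset hu)
    have : matchSum G S (s ^ 2) / (s * matchSum G (S.erase u) (s ^ 2)) =
        s⁻¹ + ∑ v ∈ S.filter (G.Adj u), s * matchSum G ((S.erase u).erase v) (s ^ 2) /
          matchSum G (S.erase u) (s ^ 2) := by
      rw [matchSum_rec G hu, ← Finset.sum_div, ← Finset.mul_sum]
      field_simp
    rw [this, Complex.add_re, Complex.re_sum]
    refine add_pos_of_pos_of_nonneg (hinv s hs) (Finset.sum_nonneg fun v hv => (h1 v ?_).le)
    obtain ⟨hvS, hadj⟩ := Finset.mem_filter.1 hv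
    exact Finset.mem_erase.2 ⟨(G.ne_of_adj hadj).symm, hvS⟩
  refine ⟨?_, fun u hu => ?_⟩
  · rcases S.eq_empty_or_nonempty with rfl | ⟨u, hu⟩
    · simp [matchSum_empty]
    · intro h
      simpa [h] using main u hu
  · have := hinv _ (main u hu)
    rwa [inv_div] at this

/-- For `|t| ≤ 1 / (4 D)` the matching sums of a graph with degrees at most `D` are positive,
also for negative `t`. -/
lemma matchSum_pos_of_small {G : SimpleGraph V} {D : ℕ}
    (hD : ∀ (S : Finset V) u, (S.filter (G.Adj u)).card ≤ D) {t : ℝ} (ht : |t| * D ≤ 1 / 4)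
    (S : Finset V) :
    0 < matchSum G S t ∧ ∀ u ∈ S, matchSum G (S.erase u) t ≤ 2 * matchSum G S t := by
  induction S using Finset.strongInduction with
  | _ S ih =>
  have main : ∀ u ∈ S, matchSum G (S.erase u) t ≤ 2 * matchSum G S t := by
    intro u hu
    obtain ⟨h0, h1⟩ := ih _ (Finset.erase_ssubset hu)
    have hsum : |t * ∑ v ∈ S.filter (G.Adj u), matchSum G ((S.erase u).erase v) t| ≤
        1 / 2 * matchSum G (S.erase u) t := by
      rw [abs_mul]
      have : |∑ v ∈ S.filter (G.Adj u), matchSum G ((S.erase u).erase v) t| ≤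
          D * (2 * matchSum G (S.erase u) t) := by
        refine (Finset.abs_sum_le_sum_abs _ _).trans ((Finset.sum_le_card_nsmul _ _
          (2 * matchSum G (S.erase u) t) fun v hv => ?_).trans ?_)
        · obtain ⟨hvS, hadj⟩ := Finset.mem_filter.1 hv
          have hv' : v ∈ S.erase u := Finset.mem_erase.2 ⟨(G.ne_of_adj hadj).symm, hvS⟩
          rw [abs_of_pos (ih _ ((Finset.erase_ssubset hv').trans (Finset.erase_ssubset hu))).1]
          exact h1 v hv'
        · rw [nsmul_eq_mul]
          gcongr
          exact hD S u
      calc _ ≤ |t| * (D * (2 * matchSum G (S.erase u) t)) := by gcongr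
        _ = (|t| * D) * (2 * matchSum G (S.erase u) t) := by ring
        _ ≤ 1 / 4 * (2 * matchSum G (S.erase u) t) := by gcongr
        _ = _ := by ring
    rw [matchSum_rec G hu]
    have := neg_le_of_abs_le hsum
    linarith
  refine ⟨?_, main⟩
  rcases S.eq_empty_or_nonempty with rfl | ⟨u, hu⟩
  · simp [matchSum_empty]
  · have := (ih _ (Finset.erase_ssubset hu)).1
    linarith [main u hu]

/-- The probability that `u` is uncovered by the random matching inside `S`, where a matching with
`k` edges has weight `t ^ k`. -/
def uncovered (G : SimpleGraph V) (S : Finset V) (u : V) (t : ℝ) : ℝ :=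
  matchSum G (S.erase u) t / matchSum G S t

lemma uncovered_rec (G : SimpleGraph V) {S : Finset V} {u : V} (hu : u ∈ S) {t : ℝ}
    (ht : 0 ≤ t) : uncovered G S u t =
      1 / (1 + t * ∑ v ∈ S.filter (G.Adj u), uncovered G (S.erase u) v t) := by
  have h0 := (matchSum_pos G (S.erase u) ht).ne'
  simp only [uncovered]
  rw [matchSum_rec G hu, ← Finset.sum_div]
  field_simp

lemma uncovered_nonneg (G : SimpleGraph V) (S : Finset V) (u : V) {t : ℝ} (ht : 0 ≤ t) :
    0 ≤ uncovered G S u t :=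
  div_nonneg (matchSum_pos G _ ht).le (matchSum_pos G _ ht).le

lemma uncovered_le_one (G : SimpleGraph V) {S : Finset V} {u : V} (hu : u ∈ S) {t : ℝ}
    (ht : 0 ≤ t) : uncovered G S u t ≤ 1 := by
  rw [uncovered_rec G hu ht]
  have : 0 ≤ t * ∑ v ∈ S.filter (G.Adj u), uncovered G (S.erase u) v t :=
    mul_nonneg ht (Finset.sum_nonneg fun v _ => uncovered_nonneg G _ v ht)
  exact div_le_one_of_le₀ (by linarith) (by linarith)

/-- Correlation decay: for small `t`, the probability that `u` is uncovered depends only weakly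
on what lies outside of the `r`-ball around `u`. -/
lemma abs_uncovered_sub_le {G : SimpleGraph V} {D : ℕ}
    (hD : ∀ (S : Finset V) u, (S.filter (G.Adj u)).card ≤ D) {t : ℝ} (ht : 0 ≤ t) (r : ℕ) :
    ∀ (S S' : Finset V) (u : V), u ∈ S → u ∈ S' →
      (∀ w, G.edist u w ≤ r → (w ∈ S ↔ w ∈ S')) →
      |uncovered G S u t - uncovered G S' u t| ≤ (t * D) ^ r := by
  induction r with
  | zero =>
    intro S S' u hu hu' _
    have h1 := uncovered_nonneg G S u ht
    have h2 := uncovered_nonneg G S' u ht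
    have h3 := uncovered_le_one G hu ht
    have h4 := uncovered_le_one G hu' ht
    rw [pow_zero, abs_le]
    constructor <;> linarith
  | succ r ih =>
    intro S S' u hu hu' hball
    have hN : S'.filter (G.Adj u) = S.filter (G.Adj u) := by
      ext w
      simp only [Finset.mem_filter, and_congr_left_iff]
      intro hadj
      refine (hball w ?_).symm
      rw [SimpleGraph.edist_eq_one_iff_adj.2 hadj]
      exact_mod_cast Nat.succ_le_succ (Nat.zero_le r)
    rw [uncovered_rec G hu ht, uncovered_rec G hu' ht, hN]
    set A := ∑ v ∈ S.filter (G.Adj u), uncovered G (S.erase u) v t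
    set B := ∑ v ∈ S.filter (G.Adj u), uncovered G (S'.erase u) v t
    have hA : 0 ≤ A := Finset.sum_nonneg fun v _ => uncovered_nonneg G _ v ht
    have hB : 0 ≤ B := Finset.sum_nonneg fun v _ => uncovered_nonneg G _ v ht
    have hAB : |B - A| ≤ D * (t * D) ^ r := by
      rw [← Finset.sum_sub_distrib]
      refine (Finset.abs_sum_le_sum_abs _ _).trans ((Finset.sum_le_card_nsmul _ _
        ((t * D) ^ r) fun v hv => ?_).trans ?_)
      · have hv' := hv
        rw [← hN] at hv'
        obtain ⟨hvS, hadj⟩ := Finset.mem_filter.1 hv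
        have hne := (G.ne_of_adj hadj).symm
        refine ih _ _ v (Finset.mem_erase.2 ⟨hne, (Finset.mem_filter.1 hv').1⟩)
          (Finset.mem_erase.2 ⟨hne, hvS⟩) fun w hw => ?_
        rw [Finset.mem_erase, Finset.mem_erase, hball w]
        calc G.edist u w ≤ G.edist u v + G.edist v w := SimpleGraph.edist_triangle
          _ ≤ 1 + r := by
            rw [SimpleGraph.edist_eq_one_iff_adj.2 hadj]
            gcongr
          _ = ((r + 1 : ℕ) : ℕ∞) := by push_cast; ring
      · rw [nsmul_eq_mul]
        gcongr
        exact hD S u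
    have h1 : 1 ≤ 1 + t * A := by nlinarith [mul_nonneg ht hA]
    have h2 : 1 ≤ 1 + t * B := by nlinarith [mul_nonneg ht hB]
    have h3 : 1 / (1 + t * A) - 1 / (1 + t * B) = t * (B - A) / ((1 + t * A) * (1 + t * B)) := by
      field_simp
      ring
    rw [h3, abs_div, abs_mul, abs_of_nonneg ht, abs_of_pos (by positivity :
      0 < (1 + t * A) * (1 + t * B))]
    calc t * |B - A| / ((1 + t * A) * (1 + t * B)) ≤ t * |B - A| :=
          div_le_self (by positivity) (one_le_mul_of_one_le_of_one_le h1 h2)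
      _ ≤ t * (D * (t * D) ^ r) := by gcongr
      _ = (t * D) ^ (r + 1) := by ring

end Inequalities

section Density

variable {V : Type} [Fintype V]

lemma density_eq [Nonempty V] (G : SimpleGraph V) {t : ℝ} (ht : 0 ≤ t) :
    density G t = 1 - (∑ u, uncovered G Finset.univ u t) / Nat.card V := by
  have hM : (genPoly G).eval t ≠ 0 := by
    rw [eval_genPoly]; exact (matchSum_pos G _ ht).ne'
  have hV : (Nat.card V : ℝ) ≠ 0 := by exact_mod_cast Nat.card_pos.ne'
  simp only [uncovered]
  rw [← Finset.sum_div, sum_matchSum_univ_erase, ← eval_genPoly, density]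
  field_simp
  ring

lemma card_filter_adj_le {G : SimpleGraph V} {D : ℕ} (hD : ∀ v, (G.neighborSet v).ncard ≤ D)
    (S : Finset V) (u : V) : (S.filter (G.Adj u)).card ≤ D := by
  refine le_trans ?_ (hD u)
  rw [← Set.ncard_coe_finset]
  exact Set.ncard_le_ncard (fun w hw => (Finset.mem_filter.1 hw).2) (Set.toFinite _)

end Density

/-! ### Locality of the density -/

section Locality

lemma ballIso_uncovered {V : Type} [Fintype V] {G : SimpleGraph V} {u : V} {r : ℕ}
    {α : RootedGraph} [Fintype α.V] (h : BallIso G u r α) (t : ℝ) :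
    uncovered G (Finset.univ.filter fun w => G.edist u w ≤ r) u t =
      uncovered α.graph Finset.univ α.root t := by
  obtain ⟨e, he⟩ := h
  let f : α.V ↪ V := e.symm.toEquiv.toEmbedding.trans (Function.Embedding.subtype _)
  have hfr : f α.root = u := by
    simp only [f, ← he]
    simp
  have hfa : ∀ a b, G.Adj (f a) (f b) ↔ α.graph.Adj a b := fun a b =>
    e.symm.map_adj_iff (v := a) (w := b)
  have hmap : (Finset.univ.map f) = Finset.univ.filter fun w => G.edist u w ≤ r := by
    ext w
    simp only [Finset.mem_map, Finset.mem_univ, true_and, Finset.mem_filter]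
    constructor
    · rintro ⟨a, rfl⟩
      exact (e.symm a).2
    · intro hw
      exact ⟨e ⟨w, hw⟩, by simp [f]⟩
  rw [uncovered, uncovered, ← hmap, ← matchSum_map f _ fun a _ b _ => hfa a b,
    ← matchSum_map f Finset.univ fun a _ b _ => hfa a b, Finset.map_erase, hfr]

/-- Codes for the finite rooted graphs with at most `N` vertices. -/
abbrev RootedCode (N : ℕ) : Type := Σ n : Fin (N + 1), SimpleGraph (Fin n) × Fin n

/-- The rooted graph with a given code. -/
def RootedCode.toRooted {N : ℕ} (x : RootedCode N) : RootedGraph := ⟨Fin x.1, x.2.1, x.2.2⟩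

instance {N : ℕ} (x : RootedCode N) : Fintype x.toRooted.V := inferInstanceAs (Fintype (Fin x.1))

/-- Isomorphism of coded rooted graphs. -/
instance rootedSetoid (N : ℕ) : Setoid (RootedCode N) where
  r x y := ∃ e : x.toRooted.graph ≃g y.toRooted.graph, e x.toRooted.root = y.toRooted.root
  iseqv :=
    ⟨fun _ => ⟨SimpleGraph.Iso.refl, rfl⟩,
      fun ⟨e, he⟩ => ⟨e.symm, by rw [← he]; exact e.symm_apply_apply _⟩,
      fun ⟨e, he⟩ ⟨e', he'⟩ => ⟨e.trans e', by rw [← he', ← he]; rfl⟩⟩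

/-- The isomorphism classes of rooted graphs with at most `N` vertices. -/
abbrev RootedClass (N : ℕ) : Type := Quotient (rootedSetoid N)

instance (N : ℕ) : Fintype (RootedClass N) := Fintype.ofFinite _

/-- Every ball with at most `N` vertices belongs to exactly one class. -/
lemma exists_class {V : Type} [Fintype V] (G : SimpleGraph V) (u : V) {r N : ℕ}
    (hN : (Finset.univ.filter fun w => G.edist u w ≤ r).card ≤ N) :
    ∃ c : RootedClass N, ∀ c' : RootedClass N,
      BallIso G u r (Quotient.out c').toRooted ↔ c = c' := by
  let B : Set V := {w | G.edist u w ≤ r}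
  have hB : Fintype.card B ≤ N := by
    rw [Fintype.card_subtype]
    exact hN
  let e : B ≃ Fin (Fintype.card B) := Fintype.equivFin B
  let x : RootedCode N := ⟨⟨Fintype.card B, by omega⟩, (G.induce B).map e.toEmbedding,
    e ⟨u, by simp [B]⟩⟩
  have hx : BallIso G u r x.toRooted := ⟨SimpleGraph.Iso.map e (G.induce B), rfl⟩
  refine ⟨⟦x⟧, fun c' => ?_⟩
  obtain ⟨e₁, h₁⟩ := hx
  constructor
  · rintro ⟨e₂, h₂⟩
    rw [← Quotient.out_eq c']
    refine Quotient.sound ⟨e₁.symm.trans e₂, ?_⟩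
    rw [← h₂, ← h₁]
    exact congrArg e₂ (e₁.symm_apply_apply _)
  · rintro rfl
    obtain ⟨e₂, h₂⟩ := Quotient.exact (Quotient.out_eq (⟦x⟧ : RootedClass N)).symm
    exact ⟨e₁.trans e₂, by rw [← h₂, ← h₁]; rfl⟩

/-- The average over all vertices of the probability to be uncovered in the `r`-ball is a
fixed linear combination of the ball frequencies. -/
lemma sum_uncovered_ball {V : Type} [Fintype V] (G : SimpleGraph V) {r N : ℕ}
    (hN : ∀ u, (Finset.univ.filter fun w => G.edist u w ≤ r).card ≤ N) (t : ℝ) :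
    (∑ u, uncovered G (Finset.univ.filter fun w => G.edist u w ≤ r) u t) / Nat.card V =
      ∑ c : RootedClass N, uncovered (Quotient.out c).toRooted.graph Finset.univ
        (Quotient.out c).toRooted.root t * ballProb G (Quotient.out c).toRooted r := by
  choose cls hcls using fun u => exists_class G u (hN u)
  rw [← Finset.sum_fiberwise Finset.univ cls, Finset.sum_div]
  refine Finset.sum_congr rfl fun c _ => ?_
  have h1 : ∀ u ∈ Finset.univ.filter (fun u => cls u = c),
      uncovered G (Finset.univ.filter fun w => G.edist u w ≤ r) u t =
        uncovered (Quotient.out c).toRooted.graph Finset.univ (Quotient.out c).toRooted.root t :=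
    fun u hu => ballIso_uncovered ((hcls u c).2 (Finset.mem_filter.1 hu).2) t
  have h2 : {v : V | BallIso G v r (Quotient.out c).toRooted} =
      ((Finset.univ.filter fun u => cls u = c : Finset V) : Set V) := by
    ext u
    simp [hcls u c]
  rw [Finset.sum_congr rfl h1, Finset.sum_const, nsmul_eq_mul, ballProb, h2,
    Set.ncard_coe_finset]
  ring

lemma card_ball_le {V : Type} [Fintype V] {G : SimpleGraph V} {D : ℕ}
    (hD : ∀ v, (G.neighborSet v).ncard ≤ D) (r : ℕ) (u : V) :
    (Finset.univ.filter fun w => G.edist u w ≤ r).card ≤ (D + 1) ^ r := by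
  induction r generalizing u with
  | zero =>
    rw [pow_zero, Finset.card_le_one]
    intro a ha b hb
    simp only [Finset.mem_filter, Nat.cast_zero, nonpos_iff_eq_zero,
      SimpleGraph.edist_eq_zero_iff] at ha hb
    rw [← ha.2, ← hb.2]
  | succ r ih =>
    have hsub : (Finset.univ.filter fun w => G.edist u w ≤ (r + 1 : ℕ)) ⊆
        insert u ((Finset.univ.filter (G.Adj u)).biUnion fun v =>
          Finset.univ.filter fun w => G.edist v w ≤ r) := by
      intro w hw
      have hw' := (Finset.mem_filter.1 hw).2
      obtain ⟨p, hp⟩ := SimpleGraph.exists_walk_of_edist_ne_top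
        (ne_top_of_le_ne_top (ENat.natCast_ne_top _) hw')
      rw [← hp] at hw'
      rcases p with _ | ⟨h, p⟩
      · simp
      · rename_i v
        refine Finset.mem_insert_of_mem (Finset.mem_biUnion.2 ⟨v, by simpa using h, ?_⟩)
        rw [SimpleGraph.Walk.length_cons] at hw'
        have : p.length ≤ r := by
          have := Nat.cast_le.1 hw'
          omega
        simp only [Finset.mem_filter, Finset.mem_univ, true_and]
        exact (SimpleGraph.edist_le p).trans (by exact_mod_cast this)
    refine (Finset.card_le_card hsub).trans ((Finset.card_insert_le _ _).trans ?_)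
    have h1 := Finset.card_biUnion_le_card_mul (Finset.univ.filter (G.Adj u))
      (fun v => Finset.univ.filter fun w => G.edist v w ≤ r) ((D + 1) ^ r) fun v _ => ih v
    have h2 := Nat.mul_le_mul_right ((D + 1) ^ r) (card_filter_adj_le hD Finset.univ u)
    have h3 : 1 ≤ (D + 1) ^ r := Nat.one_le_pow _ _ (by omega)
    calc _ ≤ D * (D + 1) ^ r + 1 := Nat.add_le_add_right (h1.trans h2) 1
      _ ≤ D * (D + 1) ^ r + (D + 1) ^ r := Nat.add_le_add_left h3 _
      _ = (D + 1) ^ (r + 1) := by ring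

lemma abs_density_sub_ball_le {V : Type} [Fintype V] [Nonempty V] {G : SimpleGraph V} {D : ℕ}
    (hD : ∀ v, (G.neighborSet v).ncard ≤ D) {t : ℝ} (ht : 0 ≤ t) (r : ℕ) :
    |density G t - (1 - (∑ u, uncovered G (Finset.univ.filter fun w => G.edist u w ≤ r) u t) /
      Nat.card V)| ≤ (t * D) ^ r := by
  have hV : (0 : ℝ) < Nat.card V := by exact_mod_cast Nat.card_pos
  rw [density_eq G ht, sub_sub_sub_cancel_left, ← sub_div, ← Finset.sum_sub_distrib, abs_div,
    abs_of_pos hV, div_le_iff₀ hV]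
  refine (Finset.abs_sum_le_sum_abs _ _).trans ((Finset.sum_le_card_nsmul _ _ ((t * D) ^ r)
    fun u _ => ?_).trans ?_)
  · exact abs_uncovered_sub_le (card_filter_adj_le hD) ht r _ _ u (by simp) (by simp)
      fun w hw => by simp [hw]
  · rw [nsmul_eq_mul, Finset.card_univ, Nat.card_eq_fintype_card, mul_comm]

/-- For small `t`, the density `p(G,t)` is continuous for Benjamini–Schramm convergence,
uniformly for graphs of bounded degree. -/
lemma tendsto_density_sub {ι : Type*} {l : Filter ι} {V W : ι → Type} [∀ i, Finite (V i)]
    [∀ i, Nonempty (V i)] [∀ i, Finite (W i)] [∀ i, Nonempty (W i)]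
    {G : ∀ i, SimpleGraph (V i)} {H : ∀ i, SimpleGraph (W i)} {D : ℕ}
    (hG : ∀ i v, ((G i).neighborSet v).ncard ≤ D) (hH : ∀ i v, ((H i).neighborSet v).ncard ≤ D)
    (hGH : ∀ (α : RootedGraph) (r : ℕ), Finite α.V → 0 < r →
      Tendsto (fun i => ballProb (G i) α r - ballProb (H i) α r) l (𝓝 0))
    {t : ℝ} (ht : 0 ≤ t) (htD : t * D ≤ 1 / 2) :
    Tendsto (fun i => density (G i) t - density (H i) t) l (𝓝 0) := by
  have _ : ∀ i, Fintype (V i) := fun i => Fintype.ofFinite _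
  have _ : ∀ i, Fintype (W i) := fun i => Fintype.ofFinite _
  rw [Metric.tendsto_nhds]
  intro ε hε
  obtain ⟨r, hr⟩ := exists_pow_lt_of_lt_one (show 0 < ε / 3 by positivity)
    (show (1 / 2 : ℝ) < 1 by norm_num)
  -- the radius of a ball event has to be positive
  have hr' : (t * D) ^ (r + 1) < ε / 3 :=
    (pow_le_pow_left₀ (by positivity) htD _).trans_lt
      ((pow_le_pow_of_le_one (by norm_num) (by norm_num) (Nat.le_succ r)).trans_lt hr)
  set a : RootedClass ((D + 1) ^ (r + 1)) → ℝ := fun c =>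
    uncovered (Quotient.out c).toRooted.graph Finset.univ (Quotient.out c).toRooted.root t
  have hlim : Tendsto (fun i => ∑ c, a c * (ballProb (G i) (Quotient.out c).toRooted (r + 1) -
      ballProb (H i) (Quotient.out c).toRooted (r + 1))) l (𝓝 0) := by
    have : (0 : ℝ) = ∑ c, a c * 0 := by simp
    rw [this]
    exact tendsto_finsetSum _ fun c _ =>
      (hGH _ _ (Finite.of_fintype _) (Nat.succ_pos r)).const_mul _
  filter_upwards [(Metric.tendsto_nhds.1 hlim) (ε / 3) (by positivity)] with i hi
  have e1 := abs_density_sub_ball_le (hG i) ht (r + 1)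
  have e2 := abs_density_sub_ball_le (hH i) ht (r + 1)
  rw [sum_uncovered_ball (G i) (card_ball_le (hG i) (r + 1))] at e1
  rw [sum_uncovered_ball (H i) (card_ball_le (hH i) (r + 1))] at e2
  simp only [mul_sub, Finset.sum_sub_distrib] at hi
  rw [Real.dist_eq, sub_zero] at hi ⊢
  rw [abs_le] at e1 e2
  rw [abs_lt] at hi ⊢
  constructor <;> linarith

end Locality

/-! ### The roots of the matching polynomials -/

section Roots

/-- The polynomial `∑ (-1)^k m_k x^(n-k)`, the monic polynomial with roots `γ_1, …, γ_n`. -/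
def gammaPoly {V : Type} (G : SimpleGraph V) : ℝ[X] :=
  ∑ k ∈ Finset.range (Nat.card V / 2 + 1),
    C ((-1) ^ k * (numMatchings G k : ℝ)) * X ^ (Nat.card V / 2 - k)

variable {V : Type} [Fintype V]

lemma gammaPoly_monic (G : SimpleGraph V) :
    (gammaPoly G).Monic ∧ (gammaPoly G).natDegree = Nat.card V / 2 := by
  have h : gammaPoly G = X ^ (Nat.card V / 2) + ∑ k ∈ Finset.range (Nat.card V / 2),
      C ((-1) ^ (k + 1) * (numMatchings G (k + 1) : ℝ)) * X ^ (Nat.card V / 2 - (k + 1)) := by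
    rw [gammaPoly, Finset.sum_range_succ', numMatchings_zero, add_comm]
    simp
  have hdeg : (∑ k ∈ Finset.range (Nat.card V / 2),
      C ((-1) ^ (k + 1) * (numMatchings G (k + 1) : ℝ)) *
        X ^ (Nat.card V / 2 - (k + 1))).degree < ((Nat.card V / 2 : ℕ) : WithBot ℕ) := by
    refine (degree_sum_le _ _).trans_lt ((Finset.sup_lt_iff (WithBot.bot_lt_coe _)).2 fun k hk => ?_)
    refine (degree_C_mul_X_pow_le _ _).trans_lt ?_
    have := Finset.mem_range.1 hk
    exact_mod_cast (show Nat.card V / 2 - (k + 1) < Nat.card V / 2 by omega)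
  rw [h]
  refine ⟨monic_X_pow_add hdeg, ?_⟩
  refine natDegree_eq_of_degree_eq_some ?_
  rw [degree_add_eq_left_of_degree_lt (by rwa [degree_X_pow]), degree_X_pow]

lemma gammaPoly_eval_map {K : Type*} [Field K] (G : SimpleGraph V) (f : ℝ →+* K) {y : K}
    (hy : y ≠ 0) : ((gammaPoly G).map f).eval y =
      y ^ (Nat.card V / 2) * matchSum G Finset.univ (-y⁻¹) := by
  rw [matchSum, ← sum_numMatchings G fun k => (-y⁻¹) ^ k, gammaPoly, Polynomial.map_sum,
    eval_finsetSum, Finset.mul_sum]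
  refine Finset.sum_congr rfl fun k hk => ?_
  have hk' : k ≤ Nat.card V / 2 := Nat.lt_succ_iff.1 (Finset.mem_range.1 hk)
  rw [Polynomial.map_mul, map_C, Polynomial.map_pow, map_X, eval_mul, eval_C, eval_pow, eval_X,
    map_mul, map_pow, map_neg, map_one, map_natCast]
  rw [neg_pow y⁻¹, inv_pow, pow_sub₀ _ hy hk']
  ring

lemma gammaPoly_eval (G : SimpleGraph V) {y : ℝ} (hy : y ≠ 0) :
    (gammaPoly G).eval y = y ^ (Nat.card V / 2) * matchSum G Finset.univ (-y⁻¹) := by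
  simpa using gammaPoly_eval_map G (RingHom.id ℝ) hy

lemma exists_sq_eq_of_mem_slitPlane {w : ℂ} (hw : w ∈ Complex.slitPlane) :
    ∃ s : ℂ, 0 < s.re ∧ s ^ 2 = w := by
  obtain ⟨s, hs⟩ := IsAlgClosed.exists_pow_nat_eq w (n := 2) (by norm_num)
  rcases lt_trichotomy s.re 0 with h | h | h
  · exact ⟨-s, by simpa using h, by rw [neg_sq, hs]⟩
  · have hre : w.re = -(s.im * s.im) := by rw [← hs, sq]; simp [h]
    have him : w.im = 0 := by rw [← hs, sq]; simp [h]
    rcases Complex.mem_slitPlane_iff.1 hw with h' | h'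
    · nlinarith [mul_self_nonneg s.im]
    · exact absurd him h'
  · exact ⟨s, h, hs⟩

/-- A complex number `y` outside of `[0,∞)` is no root: `-1 / y` is the square of some `s` with
`Re s > 0`, where the matching generating function does not vanish. -/
lemma gammaPoly_complex_root (G : SimpleGraph V) {y : ℂ}
    (hy : ((gammaPoly G).map Complex.ofRealHom).eval y = 0) : ∃ x : ℝ, 0 ≤ x ∧ (x : ℂ) = y := by
  by_contra hcon
  have hy0 : y ≠ 0 := fun h => hcon ⟨0, le_rfl, by simp [h]⟩
  have hslit : -y⁻¹ ∈ Complex.slitPlane := by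
    rw [Complex.mem_slitPlane_iff]
    by_contra! h
    have hn : 0 < Complex.normSq y := Complex.normSq_pos.2 hy0
    have him : y.im = 0 := by
      have := h.2
      rw [Complex.neg_im, Complex.inv_im, neg_eq_zero, div_eq_zero_iff] at this
      rcases this with h' | h'
      · linarith
      · exact absurd h' hn.ne'
    have hre : 0 ≤ y.re := by
      have := h.1
      rw [Complex.neg_re, Complex.inv_re] at this
      by_contra! h'
      have := div_neg_of_neg_of_pos h' hn
      linarith
    exact hcon ⟨y.re, hre, Complex.ext rfl (by simp [him])⟩
  obtain ⟨s, hs, hs2⟩ := exists_sq_eq_of_mem_slitPlane hslit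
  rw [gammaPoly_eval_map G _ hy0, ← hs2] at hy
  exact mul_ne_zero (pow_ne_zero _ hy0) (matchSum_sq_ne_zero G hs _).1 hy

lemma gammaPoly_splits (G : SimpleGraph V) : (gammaPoly G).Splits := by
  refine Splits.of_splits_map Complex.ofRealHom (IsAlgClosed.splits _) fun y hy => ?_
  obtain ⟨x, -, hx⟩ := gammaPoly_complex_root G (isRoot_of_mem_roots hy)
  exact ⟨x, hx⟩

lemma card_gammas (G : SimpleGraph V) : (gammas G).card = Nat.card V / 2 := by
  rw [← (gammaPoly_monic G).2, (gammaPoly_splits G).natDegree_eq_card_roots]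
  rfl

lemma gammaPoly_eq_prod (G : SimpleGraph V) :
    gammaPoly G = ((gammas G).map fun γ => X - C γ).prod :=
  (gammaPoly_splits G).eq_prod_roots_of_monic (gammaPoly_monic G).1

lemma gammas_nonneg {G : SimpleGraph V} {γ : ℝ} (h : γ ∈ gammas G) : 0 ≤ γ := by
  have hr : (gammaPoly G).eval γ = 0 := isRoot_of_mem_roots h
  obtain ⟨x, hx, hxγ⟩ := gammaPoly_complex_root G (y := γ) (by
    have := eval_map_apply (p := gammaPoly G) (f := Complex.ofRealHom) γ
    rw [hr] at this
    simpa using this)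
  rwa [← Complex.ofReal_injective hxγ]

lemma gammas_le {G : SimpleGraph V} {D : ℕ} (hD : ∀ v, (G.neighborSet v).ncard ≤ D) {γ : ℝ}
    (h : γ ∈ gammas G) : γ ≤ 4 * D := by
  have hr : (gammaPoly G).eval γ = 0 := isRoot_of_mem_roots h
  by_contra! hlt
  have hpos : 0 < γ := lt_of_le_of_lt (by positivity) hlt
  rw [gammaPoly_eval G hpos.ne'] at hr
  refine mul_ne_zero (pow_ne_zero _ hpos.ne') (matchSum_pos_of_small (card_filter_adj_le hD)
    (t := -γ⁻¹) ?_ Finset.univ).1.ne' hr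
  rw [abs_neg, abs_of_pos (inv_pos.2 hpos), inv_mul_le_iff₀ hpos]
  linarith

/-- The factorization `M(G,t) = ∏ (1 + γ_j t)`. -/
lemma genPoly_eq_prod (G : SimpleGraph V) :
    genPoly G = ((gammas G).map fun γ => 1 + C γ * X).prod := by
  -- the substitution `y = -1 / t` needs `t ≠ 0`; agreement at all `t > 0` is enough
  refine eq_of_infinite_eval_eq _ _ ((Set.Ioi_infinite (0 : ℝ)).mono fun t (ht : 0 < t) => ?_)
  have ht' : -t⁻¹ ≠ 0 := neg_ne_zero.2 (inv_ne_zero ht.ne')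
  have h1 := gammaPoly_eval G ht'
  rw [inv_neg, inv_inv, neg_neg, ← eval_genPoly, gammaPoly_eq_prod, ← card_gammas G,
    eval_multiset_prod, Multiset.map_map] at h1
  have h2 : ((gammas G).map ((fun p : ℝ[X] => p.eval (-t⁻¹)) ∘ fun γ => X - C γ)) =
      (gammas G).map fun γ => -t⁻¹ * (1 + γ * t) := by
    refine Multiset.map_congr rfl fun γ _ => ?_
    simp only [Function.comp_apply, eval_sub, eval_X, eval_C]
    field_simp
    ring
  rw [h2, Multiset.prod_map_mul, Multiset.map_const', Multiset.prod_replicate] at h1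
  have h3 := mul_left_cancel₀ (pow_ne_zero _ ht') h1
  show (genPoly G).eval t = _
  rw [← h3, eval_multiset_prod, Multiset.map_map]
  simp

lemma matchingPoly_eq_prod {G : SimpleGraph V} (hV : Even (Nat.card V)) :
    matchingPoly G = ((gammas G).map fun γ => (X - C √γ) * (X - C (-√γ))).prod := by
  have h1 : matchingPoly G = (gammaPoly G).comp (X ^ 2) := by
    rw [matchingPoly, gammaPoly, Polynomial.sum_comp]
    refine Finset.sum_congr rfl fun k _ => ?_
    rw [mul_comp, C_comp, X_pow_comp, ← pow_mul, Nat.mul_sub, Nat.two_mul_div_two_of_even hV]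
  rw [h1, gammaPoly_eq_prod, multiset_prod_comp, Multiset.map_map]
  congr 1
  refine Multiset.map_congr rfl fun γ hγ => ?_
  have : (C γ : ℝ[X]) = C √γ * C √γ := by rw [← C_mul, Real.mul_self_sqrt (gammas_nonneg hγ)]
  simp only [Function.comp_apply, sub_comp, X_comp, C_comp, C_neg]
  rw [this]
  ring

lemma roots_matchingPoly {G : SimpleGraph V} (hV : Even (Nat.card V)) :
    (matchingPoly G).roots = (gammas G).map Real.sqrt + (gammas G).map fun γ => -√γ := by
  rw [matchingPoly_eq_prod hV, Multiset.prod_map_mul, roots_mul]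
  · rw [← roots_multiset_prod_X_sub_C ((gammas G).map Real.sqrt),
      ← roots_multiset_prod_X_sub_C ((gammas G).map fun γ => -√γ), Multiset.map_map,
      Multiset.map_map]
    rfl
  · refine mul_ne_zero ?_ ?_ <;>
    · rw [Ne, Multiset.prod_eq_zero_iff, Multiset.mem_map]
      rintro ⟨γ, -, h⟩
      exact X_sub_C_ne_zero _ h

lemma prod_gammas (G : SimpleGraph V) :
    (gammas G).prod = numMatchings G (Nat.card V / 2) := by
  have h1 : (gammaPoly G).eval 0 =
      (-1) ^ (Nat.card V / 2) * (numMatchings G (Nat.card V / 2) : ℝ) := by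
    rw [gammaPoly, eval_finsetSum, Finset.sum_eq_single (Nat.card V / 2)]
    · simp
    · intro k hk hne
      have := Finset.mem_range.1 hk
      rw [eval_mul, eval_pow, eval_X, zero_pow (by omega), mul_zero]
    · simp
  rw [gammaPoly_eq_prod, eval_multiset_prod, Multiset.map_map, ← card_gammas G] at h1
  have h2 : ((gammas G).map ((fun p : ℝ[X] => p.eval 0) ∘ fun γ => X - C γ)) =
      (gammas G).map Neg.neg := Multiset.map_congr rfl fun γ _ => by simp
  rw [h2, Multiset.prod_map_neg] at h1
  have h3 := mul_left_cancel₀ (pow_ne_zero _ (by norm_num : (-1 : ℝ) ≠ 0)) h1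
  rw [h3, card_gammas]

end Roots

section PerfectMatchings

variable {V : Type} [Fintype V]

lemma numMatchings_half_eq_prm {G : SimpleGraph V} (hV : Even (Nat.card V)) :
    numMatchings G (Nat.card V / 2) = prm G := by
  rw [numMatchings, prm]
  congr 1
  ext M
  simp only [Set.mem_ofPred_eq, SimpleGraph.Subgraph.IsPerfectMatching]
  refine and_congr_right fun hM => ?_
  have h := card_uncovered_add (edgeSet_mem_matchingsIn hM)
  rw [← Set.ncard_eq_toFinset_card', Finset.card_univ, ← Nat.card_eq_fintype_card] at h
  have hV' := Nat.two_mul_div_two_of_even hV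
  have key : ∀ c, c + 2 * M.edgeSet.ncard = Nat.card V →
      (M.edgeSet.ncard = Nat.card V / 2 ↔ c = 0) := by omega
  rw [key _ h, Finset.card_eq_zero, Finset.eq_empty_iff_forall_notMem,
    SimpleGraph.Subgraph.IsSpanning]
  refine forall_congr' fun v => ?_
  rw [hM.verts_eq_biUnion_edgeSet]
  simp

lemma matchingNumber_spec (G : SimpleGraph V) :
    numMatchings G (matchingNumber G) ≠ 0 ∧
      ∀ k, numMatchings G k ≠ 0 → k ≤ matchingNumber G := by
  have hset : {k | ∃ M : G.Subgraph, M.IsMatching ∧ M.edgeSet.ncard = k} =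
      {k | numMatchings G k ≠ 0} := by
    ext k
    simp only [Set.mem_ofPred_eq, numMatchings]
    rw [Ne, Set.ncard_eq_zero (Set.toFinite _), ← Ne, ← Set.nonempty_iff_ne_empty]
    rfl
  have hbdd : BddAbove {k | numMatchings G k ≠ 0} := by
    refine ⟨Nat.card V, fun k hk => ?_⟩
    by_contra! h
    exact hk (numMatchings_eq_zero (by omega))
  rw [matchingNumber, hset]
  exact ⟨Nat.sSup_mem ⟨0, by simp [numMatchings_zero]⟩ hbdd, fun k hk => le_csSup hbdd hk⟩

/-- `p*(G) ≥ 1` means that `G` has a perfect matching. -/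
lemma even_and_prm_pos_of_one_le_pStar [Nonempty V] {G : SimpleGraph V} (h : 1 ≤ pStar G) :
    Even (Nat.card V) ∧ 0 < prm G := by
  have hV : (0 : ℝ) < Nat.card V := by exact_mod_cast Nat.card_pos
  rw [pStar, le_div_iff₀ hV, one_mul] at h
  have h' : Nat.card V ≤ 2 * matchingNumber G := by exact_mod_cast h
  have hm := (matchingNumber_spec G).1
  have h2 : 2 * matchingNumber G ≤ Nat.card V := by
    by_contra! hlt
    exact hm (numMatchings_eq_zero hlt)
  have he : Even (Nat.card V) := ⟨matchingNumber G, by omega⟩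
  refine ⟨he, ?_⟩
  rw [← numMatchings_half_eq_prm he, show Nat.card V / 2 = matchingNumber G by omega]
  exact Nat.pos_of_ne_zero hm

lemma pStar_eq_one [Nonempty V] {G : SimpleGraph V} (he : Even (Nat.card V)) (h : 0 < prm G) :
    pStar G = 1 := by
  have hV : (0 : ℝ) < Nat.card V := by exact_mod_cast Nat.card_pos
  rw [← numMatchings_half_eq_prm he] at h
  have h1 := (matchingNumber_spec G).2 _ h.ne'
  have h2 : 2 * matchingNumber G ≤ Nat.card V := by
    by_contra! hlt
    exact (matchingNumber_spec G).1 (numMatchings_eq_zero hlt)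
  obtain ⟨n, hn⟩ := he
  have h3 : 2 * matchingNumber G = Nat.card V := by omega
  rw [pStar, div_eq_one_iff_eq hV.ne']
  exact_mod_cast h3

end PerfectMatchings

/-! ### Integrals against the root measures -/

section RootMeasures

lemma integral_sum_dirac (s : Multiset ℝ) (f : ℝ → ℝ) :
    Integrable f (s.map fun z => Measure.dirac z).sum ∧
      ∫ x, f x ∂(s.map fun z => Measure.dirac z).sum = (s.map f).sum := by
  induction s using Multiset.induction with
  | empty => simp
  | cons a s ih =>
    have ha : Integrable f (Measure.dirac a) := integrable_dirac (by simp)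
    simp only [Multiset.map_cons, Multiset.sum_cons]
    exact ⟨ha.add_measure ih.1, by rw [integral_add_measure ha ih.1, ih.2, integral_dirac]⟩

lemma ae_sum_dirac {s : Multiset ℝ} {p : ℝ → Prop} (h : ∀ x ∈ s, p x) :
    ∀ᵐ x ∂(s.map fun z => Measure.dirac z).sum, p x := by
  induction s using Multiset.induction with
  | empty => simp
  | cons a s ih =>
    simp only [Multiset.map_cons, Multiset.sum_cons, ae_add_measure_iff]
    refine ⟨?_, ih fun x hx => h x (Multiset.mem_cons_of_mem hx)⟩
    rw [ae_dirac_eq]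
    exact h a (Multiset.mem_cons_self a s)

lemma sum_dirac_univ (s : Multiset ℝ) :
    (s.map fun z => Measure.dirac z).sum Set.univ = (s.card : ℝ≥0∞) := by
  induction s using Multiset.induction with
  | empty => simp
  | cons a s ih =>
    simp only [Multiset.map_cons, Multiset.sum_cons, Measure.add_apply, ih, measure_univ,
      Multiset.card_cons]
    push_cast
    ring

variable {V : Type}

lemma card_eq_two_mul_half (hV : Even (Nat.card V)) :
    (Nat.card V : ℝ) = 2 * ((Nat.card V / 2 : ℕ) : ℝ) := by
  exact_mod_cast (Nat.two_mul_div_two_of_even hV).symm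

lemma integral_gammaMeasure (G : SimpleGraph V) (f : ℝ → ℝ) :
    ∫ x, f x ∂(gammaMeasure G) = ((gammas G).map f).sum / (Nat.card V / 2 : ℕ) := by
  rw [gammaMeasure, integral_smul_measure, (integral_sum_dirac _ f).2, ENNReal.toReal_inv,
    ENNReal.toReal_natCast, smul_eq_mul]
  ring

lemma ae_gammaMeasure {G : SimpleGraph V} {p : ℝ → Prop} (h : ∀ x ∈ gammas G, p x) :
    ∀ᵐ x ∂(gammaMeasure G), p x :=
  Measure.ae_smul_measure (ae_sum_dirac h) _

variable [Fintype V]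

lemma half_card_pos [Nonempty V] (hV : Even (Nat.card V)) : 0 < Nat.card V / 2 := by
  have h1 : 0 < Nat.card V := Nat.card_pos
  obtain ⟨n, hn⟩ := hV
  omega

lemma isProbabilityMeasure_gammaMeasure [Nonempty V] (hV : Even (Nat.card V))
    (G : SimpleGraph V) : IsProbabilityMeasure (gammaMeasure G) := by
  constructor
  rw [gammaMeasure, Measure.smul_apply, sum_dirac_univ, card_gammas, smul_eq_mul]
  exact ENNReal.inv_mul_cancel (by exact_mod_cast (half_card_pos hV).ne')
    (ENNReal.natCast_ne_top _)

lemma integral_matchingMeasure (hV : Even (Nat.card V)) (G : SimpleGraph V) (f : ℝ → ℝ) :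
    ∫ x, f x ∂(matchingMeasure G) = ∫ x, (f (√x) + f (-√x)) / 2 ∂(gammaMeasure G) := by
  rw [matchingMeasure, integral_smul_measure, (integral_sum_dirac _ f).2, ENNReal.toReal_inv,
    ENNReal.toReal_natCast, smul_eq_mul, roots_matchingPoly hV, integral_gammaMeasure,
    Multiset.map_add, Multiset.sum_add, Multiset.map_map, Multiset.map_map,
    card_eq_two_mul_half hV, ← Multiset.sum_map_add, Multiset.sum_map_div]
  simp only [Function.comp_apply]
  rw [mul_inv]
  ring

/-- The logarithmic derivative of `∏ (1 + γ_j t)`, multiplied by `t`. -/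
lemma mul_derivative_prod_div (s : Multiset ℝ) {t : ℝ} (h : ∀ x ∈ s, 1 + x * t ≠ 0) :
    ((s.map fun γ => 1 + C γ * X).prod : ℝ[X]).eval t ≠ 0 ∧
    t * (derivative (s.map fun γ => 1 + C γ * X).prod).eval t /
      ((s.map fun γ => 1 + C γ * X).prod : ℝ[X]).eval t =
        (s.map fun x => x * t / (1 + x * t)).sum := by
  induction s using Multiset.induction with
  | empty => simp
  | cons a s ih =>
    obtain ⟨h1, h2⟩ := ih fun x hx => h x (Multiset.mem_cons_of_mem hx)
    have ha := h a (Multiset.mem_cons_self a s)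
    simp only [Multiset.map_cons, Multiset.prod_cons, Multiset.sum_cons, eval_mul, ← h2,
      derivative_mul, eval_add, eval_one, eval_C, eval_X, derivative_add, derivative_one,
      derivative_C, derivative_X, zero_mul, mul_one, zero_add]
    refine ⟨mul_ne_zero ha h1, ?_⟩
    generalize (s.map fun γ => 1 + C γ * X).prod = P at h1
    rw [div_add_div _ _ ha h1, mul_add]
    ring

lemma one_add_gamma_mul_pos {G : SimpleGraph V} {t : ℝ} (ht : 0 ≤ t) :
    ∀ x ∈ gammas G, 0 < 1 + x * t := fun _ hx => by
  have := mul_nonneg (gammas_nonneg hx) ht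
  linarith

lemma density_eq_integral (hV : Even (Nat.card V)) (G : SimpleGraph V) {t : ℝ} (ht : 0 ≤ t) :
    density G t = ∫ x, x * t / (1 + x * t) ∂(gammaMeasure G) := by
  rw [integral_gammaMeasure, ← (mul_derivative_prod_div (gammas G)
    fun x hx => (one_add_gamma_mul_pos ht x hx).ne').2, ← genPoly_eq_prod, density,
    card_eq_two_mul_half hV]
  field_simp

lemma log_genPoly_eq_integral (hV : Even (Nat.card V)) (G : SimpleGraph V) {t : ℝ}
    (ht : 0 ≤ t) : Real.log ((genPoly G).eval t) / Nat.card V =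
      1 / 2 * ∫ x, Real.log (1 + x * t) ∂(gammaMeasure G) := by
  rw [integral_gammaMeasure, genPoly_eq_prod, eval_multiset_prod, Multiset.map_map,
    Real.log_multiset_prod, Multiset.map_map, card_eq_two_mul_half hV]
  · simp only [Function.comp_def, eval_add, eval_one, eval_mul, eval_C, eval_X]
    ring
  · intro y hy
    obtain ⟨x, hx, rfl⟩ := Multiset.mem_map.1 hy
    simpa using (one_add_gamma_mul_pos ht x hx).ne'

lemma gammas_pos {G : SimpleGraph V} (hV : Even (Nat.card V)) (h : 0 < prm G) {γ : ℝ}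
    (hγ : γ ∈ gammas G) : 0 < γ := by
  refine lt_of_le_of_ne (gammas_nonneg hγ) ?_
  rintro rfl
  have := prod_gammas G
  rw [Multiset.prod_eq_zero hγ, numMatchings_half_eq_prm hV] at this
  exact h.ne (by exact_mod_cast this)

lemma log_prm_eq_integral (hV : Even (Nat.card V)) {G : SimpleGraph V} (h : 0 < prm G) :
    Real.log (prm G) / Nat.card V = 1 / 2 * ∫ x, Real.log x ∂(gammaMeasure G) := by
  rw [integral_gammaMeasure, ← numMatchings_half_eq_prm hV, ← prod_gammas,
    Real.log_multiset_prod fun x hx => (gammas_pos hV h hx).ne', card_eq_two_mul_half hV]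
  ring

end RootMeasures

/-! ### Weak convergence from convergence of the densities at small activities -/

section WeakConvergence

variable {K : ℝ}

lemma integrable_of_continuousOn {ν : Measure ℝ} [IsFiniteMeasure ν]
    (hν : ∀ᵐ x ∂ν, x ∈ Set.Icc 0 K) {f : ℝ → ℝ} (hf : ContinuousOn f (Set.Icc 0 K)) :
    Integrable f ν := by
  have := hf.integrableOn_compact (μ := ν) isCompact_Icc
  rwa [IntegrableOn, Measure.restrict_eq_self_of_ae_mem hν] at this

section Difference

variable {ι : Type*} {l : Filter ι} {ν ν' : ι → Measure ℝ} [∀ i, IsProbabilityMeasure (ν i)]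
  [∀ i, IsProbabilityMeasure (ν' i)]

/-- The function `f` is continuous on `[0,K]`, and the measures `ν i` and `ν' i` asymptotically
have the same integral of `f`. -/
def AsympEq (K : ℝ) (l : Filter ι) (ν ν' : ι → Measure ℝ) (f : ℝ → ℝ) : Prop :=
  ContinuousOn f (Set.Icc 0 K) ∧ Tendsto (fun i => ∫ x, f x ∂(ν i) - ∫ x, f x ∂(ν' i)) l (𝓝 0)

lemma AsympEq.of_approx (hν : ∀ i, ∀ᵐ x ∂(ν i), x ∈ Set.Icc 0 K)
    (hν' : ∀ i, ∀ᵐ x ∂(ν' i), x ∈ Set.Icc 0 K) {g : ℝ → ℝ} (hg : ContinuousOn g (Set.Icc 0 K))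
    (h : ∀ ε > 0, ∃ f, AsympEq K l ν ν' f ∧ ∀ x ∈ Set.Icc 0 K, |g x - f x| ≤ ε) :
    AsympEq K l ν ν' g := by
  refine ⟨hg, Metric.tendsto_nhds.2 fun ε hε => ?_⟩
  obtain ⟨f, ⟨hfc, hf⟩, hfg⟩ := h (ε / 4) (by positivity)
  have key : ∀ (m : Measure ℝ) [IsProbabilityMeasure m], (∀ᵐ x ∂m, x ∈ Set.Icc 0 K) →
      |∫ x, g x ∂m - ∫ x, f x ∂m| ≤ ε / 4 := by
    intro m _ hm
    rw [← integral_sub (integrable_of_continuousOn hm hg) (integrable_of_continuousOn hm hfc)]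
    have := norm_integral_le_of_norm_le_const (μ := m) (f := fun x => g x - f x) (C := ε / 4)
      (hm.mono fun x hx => hfg x hx)
    simpa using this
  filter_upwards [Metric.tendsto_nhds.1 hf (ε / 4) (by positivity)] with i hi
  have h1 := key (ν i) (hν i)
  have h2 := key (ν' i) (hν' i)
  rw [Real.dist_eq, sub_zero] at hi ⊢
  rw [abs_le] at h1 h2
  rw [abs_lt] at hi ⊢
  constructor <;> linarith

lemma AsympEq.congr (hν : ∀ i, ∀ᵐ x ∂(ν i), x ∈ Set.Icc 0 K)
    (hν' : ∀ i, ∀ᵐ x ∂(ν' i), x ∈ Set.Icc 0 K) {f g : ℝ → ℝ} (hf : AsympEq K l ν ν' f)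
    (h : ∀ x ∈ Set.Icc 0 K, f x = g x) : AsympEq K l ν ν' g :=
  AsympEq.of_approx hν hν' (hf.1.congr fun x hx => (h x hx).symm) fun ε hε =>
    ⟨f, hf, fun x hx => by simp [h x hx, hε.le]⟩

lemma AsympEq.linearComb (hν : ∀ i, ∀ᵐ x ∂(ν i), x ∈ Set.Icc 0 K)
    (hν' : ∀ i, ∀ᵐ x ∂(ν' i), x ∈ Set.Icc 0 K) {f g : ℝ → ℝ} (hf : AsympEq K l ν ν' f)
    (hg : AsympEq K l ν ν' g) (a b : ℝ) : AsympEq K l ν ν' fun x => a * f x + b * g x := by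
  refine ⟨(hf.1.const_mul a).add (hg.1.const_mul b), ?_⟩
  have := (hf.2.const_mul a).add (hg.2.const_mul b)
  rw [mul_zero, mul_zero, add_zero] at this
  refine this.congr fun i => ?_
  have key : ∀ (m : Measure ℝ) [IsProbabilityMeasure m], (∀ᵐ x ∂m, x ∈ Set.Icc 0 K) →
      ∫ x, a * f x + b * g x ∂m = a * ∫ x, f x ∂m + b * ∫ x, g x ∂m := fun m _ hm => by
    rw [integral_add ((integrable_of_continuousOn hm hf.1).const_mul a)
      ((integrable_of_continuousOn hm hg.1).const_mul b), integral_const_mul, integral_const_mul]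
  rw [key _ (hν i), key _ (hν' i)]
  ring

lemma one_add_mul_pos {t x : ℝ} (ht : 0 ≤ t) (hx : x ∈ Set.Icc 0 K) : 0 < 1 + x * t := by
  have := mul_nonneg hx.1 ht
  linarith

lemma continuousOn_div_one_add {f : ℝ → ℝ} (hf : Continuous f) {t : ℝ} (ht : 0 ≤ t) :
    ContinuousOn (fun x => f x / (1 + x * t)) (Set.Icc 0 K) :=
  hf.continuousOn.div (by fun_prop) fun _ hx => (one_add_mul_pos ht hx).ne'

/-- The integrals of `x t / (1 + x t)` for small `t` determine the moments, as
`x ^ (k+1) / (1 + x t) = (x ^ k - x ^ k / (1 + x t)) / t` and `x ^ k / (1 + x t)` tends to `x ^ k`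
for `t → 0`. By the Weierstrass theorem, they determine all integrals of continuous functions. -/
lemma AsympEq.of_density (hν : ∀ i, ∀ᵐ x ∂(ν i), x ∈ Set.Icc 0 K)
    (hν' : ∀ i, ∀ᵐ x ∂(ν' i), x ∈ Set.Icc 0 K) {δ : ℝ} (hδ : 0 < δ)
    (h : ∀ t, 0 < t → t ≤ δ → Tendsto (fun i => ∫ x, x * t / (1 + x * t) ∂(ν i) -
      ∫ x, x * t / (1 + x * t) ∂(ν' i)) l (𝓝 0))
    {f : ℝ → ℝ} (hf : ContinuousOn f (Set.Icc 0 K)) : AsympEq K l ν ν' f := by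
  have hone : AsympEq K l ν ν' fun _ => 1 := ⟨continuousOn_const, by simpa using tendsto_const_nhds⟩
  have hpow_of : ∀ k : ℕ, (∀ t, 0 < t → t ≤ δ → AsympEq K l ν ν' fun x => x ^ k / (1 + x * t)) →
      AsympEq K l ν ν' fun x => x ^ k := by
    intro k hk
    refine AsympEq.of_approx hν hν' (continuous_pow k).continuousOn fun ε hε => ?_
    set t := min δ (ε / (|K| ^ (k + 1) + 1)) with ht
    have ht0 : 0 < t := lt_min hδ (by positivity)
    refine ⟨_, hk t ht0 (min_le_left _ _), fun x hx => ?_⟩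
    have h1 := one_add_mul_pos ht0.le hx
    have hxK : x ≤ |K| := hx.2.trans (le_abs_self K)
    have h2 : x ^ k - x ^ k / (1 + x * t) = x ^ (k + 1) * t / (1 + x * t) := by
      field_simp
      ring
    have hx0 := hx.1
    rw [h2, abs_of_nonneg (by positivity)]
    calc x ^ (k + 1) * t / (1 + x * t) ≤ x ^ (k + 1) * t :=
          div_le_self (by positivity) (by nlinarith [mul_nonneg hx0 ht0.le])
      _ ≤ (|K| ^ (k + 1) + 1) * (ε / (|K| ^ (k + 1) + 1)) := by
          gcongr
          · exact (pow_le_pow_left₀ hx0 hxK _).trans (by linarith)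
          · exact min_le_right _ _
      _ = ε := by field_simp
  have hdiv : ∀ k : ℕ, ∀ t, 0 < t → t ≤ δ → AsympEq K l ν ν' fun x => x ^ k / (1 + x * t) := by
    intro k
    induction k with
    | zero =>
      intro t ht htδ
      have h1 : AsympEq K l ν ν' fun x => x * t / (1 + x * t) :=
        ⟨continuousOn_div_one_add (by fun_prop) ht.le, h t ht htδ⟩
      refine (hone.linearComb hν hν' h1 1 (-1)).congr hν hν' fun x hx => ?_
      have := one_add_mul_pos ht.le hx
      field_simp
      ring
    | succ k ih =>
      intro t ht htδ
      refine ((hpow_of k ih).linearComb hν hν' (ih t ht htδ) t⁻¹ (-t⁻¹)).congr hν hν'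
        fun x hx => ?_
      have h0 := (one_add_mul_pos ht.le hx).ne'
      have e1 : x ^ k / (1 + x * t) * (1 + x * t) = x ^ k := div_mul_cancel₀ _ h0
      have e2 : t⁻¹ * t = 1 := inv_mul_cancel₀ ht.ne'
      rw [eq_div_iff h0]
      linear_combination (-t⁻¹) * e1 + x ^ (k + 1) * e2
  have hpoly : ∀ p : ℝ[X], AsympEq K l ν ν' fun x => p.eval x := by
    intro p
    induction p using Polynomial.induction_on' with
    | add p q hp hq =>
      exact (hp.linearComb hν hν' hq 1 1).congr hν hν' fun x _ => by simp
    | monomial n a =>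
      exact ((hpow_of n (hdiv n)).linearComb hν hν' hone a 0).congr hν hν' fun x _ => by simp
  refine AsympEq.of_approx hν hν' hf fun ε hε => ?_
  obtain ⟨p, hp⟩ := exists_polynomial_near_of_continuousOn 0 K f hf ε hε
  exact ⟨_, hpoly p, fun x hx => by rw [abs_sub_comm]; exact (hp x hx).le⟩

end Difference

lemma exists_boundedContinuous_eqOn (hK : 0 ≤ K) {f : ℝ → ℝ} (hf : ContinuousOn f (Set.Icc 0 K)) :
    ∃ g : ℝ →ᵇ ℝ, ∀ x ∈ Set.Icc 0 K, g x = f x := by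
  let f' : C(Set.Icc 0 K, ℝ) := ⟨_, hf.domRestrict⟩
  refine ⟨(BoundedContinuousFunction.mkOfCompact f').compContinuous
    ⟨Set.projIcc 0 K hK, continuous_projIcc⟩, fun x hx => ?_⟩
  simp [f', Set.projIcc_of_mem hK hx]

lemma WeakConv.tendsto_integral (hK : 0 ≤ K) {ν : ℕ → Measure ℝ} {ν' : Measure ℝ}
    (h : WeakConv ν ν') (hν : ∀ i, ∀ᵐ x ∂(ν i), x ∈ Set.Icc 0 K)
    (hν' : ∀ᵐ x ∂ν', x ∈ Set.Icc 0 K) {f : ℝ → ℝ} (hf : ContinuousOn f (Set.Icc 0 K)) :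
    Tendsto (fun i => ∫ x, f x ∂(ν i)) atTop (𝓝 (∫ x, f x ∂ν')) := by
  obtain ⟨g, hg⟩ := exists_boundedContinuous_eqOn hK hf
  have key : ∀ m : Measure ℝ, (∀ᵐ x ∂m, x ∈ Set.Icc 0 K) → ∫ x, g x ∂m = ∫ x, f x ∂m :=
    fun m hm => integral_congr_ae (hm.mono fun x hx => hg x hx)
  rw [← key _ hν']
  exact (h g).congr fun i => key _ (hν i)

/-- Probability measures on `[0,K]` whose integrals of continuous functions are Cauchy sequences
converge weakly to a probability measure on `[0,K]`, by Prokhorov's theorem. -/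
lemma exists_weakConv {ν : ℕ → Measure ℝ} [∀ i, IsProbabilityMeasure (ν i)]
    (hν : ∀ i, ∀ᵐ x ∂(ν i), x ∈ Set.Icc 0 K)
    (h : ∀ f : ℝ →ᵇ ℝ, Tendsto (fun p : ℕ × ℕ => ∫ x, f x ∂(ν p.1) - ∫ x, f x ∂(ν p.2))
      (atTop ×ˢ atTop) (𝓝 0)) :
    ∃ ν' : Measure ℝ, IsProbabilityMeasure ν' ∧ (∀ᵐ x ∂ν', x ∈ Set.Icc 0 K) ∧ WeakConv ν ν' := by
  let P : ℕ → ProbabilityMeasure ℝ := fun i => ⟨ν i, inferInstance⟩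
  have hsupp : ∀ i, P i ∈ {μ : ProbabilityMeasure ℝ | ∀ _ : ℕ, μ (Set.Icc 0 K)ᶜ ≤ 0} := by
    intro i _
    rw [nonpos_iff_eq_zero, ← ENNReal.coe_eq_zero, ProbabilityMeasure.ennreal_coeFn_eq_coeFn_toMeasure]
    exact hν i
  have hcomp : IsCompact {μ : ProbabilityMeasure ℝ | ∀ _ : ℕ, μ (Set.Icc 0 K)ᶜ ≤ 0} :=
    isCompact_setOfPred_probabilityMeasure_mass_eq_compl_isCompact_le (u := fun _ => 0)
      (K := fun _ => Set.Icc 0 K) tendsto_const_nhds (fun _ => isCompact_Icc)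
      (Or.inl inferInstance)
  obtain ⟨P', hP', hlim⟩ := hcomp.ultrafilter_le_nhds' (Ultrafilter.map P (hyperfilter ℕ))
    (Ultrafilter.mem_map.2 (Filter.Eventually.of_forall hsupp))
  have hlim' : Tendsto P (hyperfilter ℕ) (𝓝 P') := hlim
  rw [ProbabilityMeasure.tendsto_iff_forall_integral_tendsto] at hlim'
  refine ⟨P', inferInstance, ?_, fun f => ?_⟩
  · have := hP' 0
    rwa [nonpos_iff_eq_zero, ← ENNReal.coe_eq_zero,
      ProbabilityMeasure.ennreal_coeFn_eq_coeFn_toMeasure] at this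
  · have hc : CauchySeq fun i => ∫ x, f x ∂(ν i) := by
      rw [cauchySeq_iff_tendsto_dist_atTop_0, ← prod_atTop_atTop_eq]
      simpa [Real.dist_eq] using (h f).abs
    obtain ⟨a, ha⟩ := cauchySeq_tendsto_of_complete hc
    have hle : (hyperfilter ℕ : Filter ℕ) ≤ atTop := by
      rw [← Nat.cofinite_eq_atTop]; exact hyperfilter_le_cofinite
    rwa [tendsto_nhds_unique (hlim' f) (ha.mono_left hle)]

end WeakConvergence

/-! ### Density and entropy of a measure -/

section MeasureEntropy

/-- The density `∫ x t / (1 + x t) dν(x)`. For the measure `ν` of a graph `G` this is `p(G,t)`. -/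
def measDensity (ν : Measure ℝ) (t : ℝ) : ℝ := ∫ x, x * t / (1 + x * t) ∂ν

/-- The function `F(G,t)`, expressed through the measure of the graph. -/
def measEnergy (ν : Measure ℝ) (t : ℝ) : ℝ :=
  1 / 2 * ∫ x, Real.log (1 + x * t) ∂ν - 1 / 2 * measDensity ν t * Real.log t

variable {K : ℝ} {ν : Measure ℝ} [IsProbabilityMeasure ν]

lemma measDensity_zero (ν : Measure ℝ) : measDensity ν 0 = 0 := by simp [measDensity]

lemma integrable_density (hν : ∀ᵐ x ∂ν, x ∈ Set.Icc 0 K) {t : ℝ} (ht : 0 ≤ t) :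
    Integrable (fun x => x * t / (1 + x * t)) ν :=
  integrable_of_continuousOn hν (continuousOn_div_one_add (by fun_prop) ht)

lemma integrable_log_add (hν : ∀ᵐ x ∂ν, x ∈ Set.Icc 0 K) {s : ℝ} (hs : 0 < s) :
    Integrable (fun x => Real.log (x + s)) ν :=
  integrable_of_continuousOn hν (ContinuousOn.log (by fun_prop) fun x hx => by
    have := hx.1; positivity)

lemma integrable_log_one_add_mul (hν : ∀ᵐ x ∂ν, x ∈ Set.Icc 0 K) {t : ℝ} (ht : 0 ≤ t) :
    Integrable (fun x => Real.log (1 + x * t)) ν :=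
  integrable_of_continuousOn hν (ContinuousOn.log (by fun_prop) fun _ hx =>
    (one_add_mul_pos ht hx).ne')

lemma measDensity_sub (hν : ∀ᵐ x ∂ν, x ∈ Set.Icc 0 K) {s t : ℝ} (hs : 0 ≤ s) (ht : 0 ≤ t) :
    measDensity ν t - measDensity ν s =
      ∫ x, x * (t - s) / ((1 + x * t) * (1 + x * s)) ∂ν := by
  rw [measDensity, measDensity, ← integral_sub (integrable_density hν ht)
    (integrable_density hν hs)]
  refine integral_congr_ae (hν.mono fun x hx => ?_)
  have h1 := one_add_mul_pos hs hx
  have h2 := one_add_mul_pos ht hx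
  dsimp only
  rw [div_sub_div _ _ h2.ne' h1.ne']
  congr 1
  ring

lemma measDensity_le_one (hν : ∀ᵐ x ∂ν, x ∈ Set.Icc 0 K) {t : ℝ} (ht : 0 ≤ t) :
    measDensity ν t ≤ 1 := by
  have : ∫ x, x * t / (1 + x * t) ∂ν ≤ ∫ _, (1 : ℝ) ∂ν := by
    refine integral_mono_ae (integrable_density hν ht) (integrable_const 1)
      (hν.mono fun x hx => ?_)
    have := one_add_mul_pos ht hx
    exact div_le_one_of_le₀ (by linarith) this.le
  simpa [measDensity] using this

lemma measDensity_mono (hν : ∀ᵐ x ∂ν, x ∈ Set.Icc 0 K) {s t : ℝ} (hs : 0 ≤ s) (hst : s ≤ t) :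
    measDensity ν s ≤ measDensity ν t := by
  rw [← sub_nonneg, measDensity_sub hν hs (hs.trans hst)]
  refine integral_nonneg_of_ae (hν.mono fun x hx => ?_)
  exact div_nonneg (mul_nonneg hx.1 (sub_nonneg.2 hst))
    (mul_pos (one_add_mul_pos (hs.trans hst) hx) (one_add_mul_pos hs hx)).le

lemma measDensity_strictMono (hν : ∀ᵐ x ∂ν, x ∈ Set.Icc 0 K) (hpos : ∀ᵐ x ∂ν, 0 < x)
    {s t : ℝ} (hs : 0 ≤ s) (hst : s < t) : measDensity ν s < measDensity ν t := by
  have ht := hs.trans hst.le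
  refine lt_of_le_of_ne (measDensity_mono hν hs hst.le) fun heq => ?_
  have h0 := measDensity_sub hν hs ht
  rw [heq, sub_self, eq_comm, integral_eq_zero_iff_of_nonneg_ae] at h0
  · obtain ⟨x, hx1, hx2, hx3⟩ := (h0.and (hpos.and hν)).exists
    have h1 := one_add_mul_pos hs hx3
    have h2 := one_add_mul_pos ht hx3
    have : 0 < x * (t - s) / ((1 + x * t) * (1 + x * s)) :=
      div_pos (mul_pos hx2 (sub_pos.2 hst)) (mul_pos h2 h1)
    exact this.ne' hx1
  · exact hν.mono fun x hx => div_nonneg (mul_nonneg hx.1 (sub_nonneg.2 hst.le))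
      (mul_pos (one_add_mul_pos ht hx) (one_add_mul_pos hs hx)).le
  · refine integrable_of_continuousOn hν (ContinuousOn.div (by fun_prop) (by fun_prop) ?_)
    exact fun x hx => (mul_pos (one_add_mul_pos ht hx) (one_add_mul_pos hs hx)).ne'

lemma measDensity_lt_one (hν : ∀ᵐ x ∂ν, x ∈ Set.Icc 0 K) (hpos : ∀ᵐ x ∂ν, 0 < x) {t : ℝ}
    (ht : 0 ≤ t) : measDensity ν t < 1 :=
  (measDensity_strictMono hν hpos ht (lt_add_one t)).trans_le
    (measDensity_le_one hν (by linarith))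

lemma continuousOn_measDensity (hν : ∀ᵐ x ∂ν, x ∈ Set.Icc 0 K) :
    ContinuousOn (measDensity ν) (Set.Ici 0) := by
  intro t ht
  refine tendsto_integral_filter_of_dominated_convergence (fun _ => 1) ?_ ?_
    (integrable_const 1) ?_
  · filter_upwards [self_mem_nhdsWithin] with s hs
    exact (integrable_density hν hs).aestronglyMeasurable
  · filter_upwards [self_mem_nhdsWithin] with s hs
    filter_upwards [hν] with x hx
    have h := one_add_mul_pos hs hx
    rw [Real.norm_of_nonneg (div_nonneg (mul_nonneg hx.1 hs) h.le)]
    exact div_le_one_of_le₀ (by linarith) h.le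
  · filter_upwards [hν] with x hx
    have h := one_add_mul_pos ht hx
    have : ContinuousAt (fun s => x * s / (1 + x * s)) t :=
      ContinuousAt.div (by fun_prop) (by fun_prop) h.ne'
    exact this.continuousWithinAt

lemma tendsto_measDensity_atTop (hν : ∀ᵐ x ∂ν, x ∈ Set.Icc 0 K) (hpos : ∀ᵐ x ∂ν, 0 < x) :
    Tendsto (measDensity ν) atTop (𝓝 1) := by
  have h1 : (1 : ℝ) = ∫ _, (1 : ℝ) ∂ν := by simp
  rw [h1]
  refine tendsto_integral_filter_of_dominated_convergence (fun _ => 1) ?_ ?_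
    (integrable_const 1) ?_
  · filter_upwards [eventually_ge_atTop 0] with s hs
    exact (integrable_density hν hs).aestronglyMeasurable
  · filter_upwards [eventually_ge_atTop 0] with s hs
    filter_upwards [hν] with x hx
    have h := one_add_mul_pos hs hx
    rw [Real.norm_of_nonneg (div_nonneg (mul_nonneg hx.1 hs) h.le)]
    exact div_le_one_of_le₀ (by linarith) h.le
  · filter_upwards [hpos] with x hx
    have h2 : Tendsto (fun s : ℝ => 1 - (1 + x * s)⁻¹) atTop (𝓝 (1 - 0)) :=
      tendsto_const_nhds.sub (tendsto_inv_atTop_zero.comp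
        (tendsto_atTop_add_const_left _ _ (tendsto_id.const_mul_atTop hx)))
    rw [sub_zero] at h2
    refine h2.congr' ?_
    filter_upwards [eventually_ge_atTop 0] with s hs
    have : 0 < 1 + x * s := by positivity
    field_simp
    ring

/-- The inverse function of the density is defined on `[0,1)` if `ν` has no atom at `0`. -/
lemma exists_measDensity_eq (hν : ∀ᵐ x ∂ν, x ∈ Set.Icc 0 K) (hpos : ∀ᵐ x ∂ν, 0 < x) {p : ℝ}
    (hp0 : 0 ≤ p) (hp1 : p < 1) : ∃ t, 0 ≤ t ∧ measDensity ν t = p := by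
  obtain ⟨T, hT, hT0⟩ := (((tendsto_measDensity_atTop hν hpos).eventually_const_lt hp1).and
    (eventually_ge_atTop 0)).exists
  obtain ⟨t, ht, htp⟩ := intermediate_value_Icc hT0
    ((continuousOn_measDensity hν).mono Set.Icc_subset_Ici_self)
    ⟨(measDensity_zero ν).le.trans hp0, hT.le⟩
  exact ⟨t, ht.1, htp⟩

/-- Any right inverse of the density tends to infinity at `1`. -/
lemma tendsto_atTop_of_measDensity_eq (hν : ∀ᵐ x ∂ν, x ∈ Set.Icc 0 K) (hpos : ∀ᵐ x ∂ν, 0 < x)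
    {T : ℝ → ℝ} (hT : ∀ p, 0 ≤ p → p < 1 → 0 ≤ T p ∧ measDensity ν (T p) = p) :
    Tendsto T (𝓝[<] 1) atTop := by
  rw [tendsto_atTop]
  intro A
  have h1 := measDensity_lt_one hν hpos (le_max_right A 0)
  have h0 : 0 ≤ measDensity ν (max A 0) :=
    (measDensity_zero ν).symm.le.trans (measDensity_mono hν le_rfl (le_max_right A 0))
  filter_upwards [Ioo_mem_nhdsLT h1] with p hp
  by_contra! hlt
  obtain ⟨h2, h3⟩ := hT p (h0.trans hp.1.le) hp.2
  have := measDensity_mono hν h2 (hlt.le.trans (le_max_left A 0))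
  rw [h3] at this
  exact absurd hp.1 this.not_gt

lemma tendsto_integral_log_add (hν : ∀ᵐ x ∂ν, x ∈ Set.Icc 0 K) (hpos : ∀ᵐ x ∂ν, 0 < x)
    (hlog : Integrable Real.log ν) :
    Tendsto (fun s => ∫ x, Real.log (x + s) ∂ν) (𝓝[>] 0) (𝓝 (∫ x, Real.log x ∂ν)) := by
  refine tendsto_integral_filter_of_dominated_convergence
    (fun x => |Real.log x| + |Real.log (|K| + 1)|) ?_ ?_ (hlog.abs.add (integrable_const _)) ?_
  · filter_upwards [self_mem_nhdsWithin] with s hs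
    exact (integrable_log_add hν hs).aestronglyMeasurable
  · filter_upwards [Ioo_mem_nhdsGT (zero_lt_one (α := ℝ))] with s hs
    filter_upwards [hν, hpos] with x hx hx0
    have h1 : Real.log x ≤ Real.log (x + s) := Real.log_le_log hx0 (by linarith [hs.1])
    have h2 : Real.log (x + s) ≤ Real.log (|K| + 1) :=
      Real.log_le_log (by linarith [hs.1]) (by linarith [hs.2, hx.2, le_abs_self K])
    have h3 := neg_abs_le (Real.log x)
    have h4 := le_abs_self (Real.log (|K| + 1))
    rw [Real.norm_eq_abs, abs_le]
    constructor <;> linarith [abs_nonneg (Real.log x), abs_nonneg (Real.log (|K| + 1))]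
  · filter_upwards [hpos] with x hx
    have : ContinuousAt (fun s => Real.log (x + s)) 0 :=
      ContinuousAt.log (by fun_prop) (by simpa using hx.ne')
    have h2 := this.continuousWithinAt (s := Set.Ioi 0)
    rw [ContinuousWithinAt, add_zero] at h2
    exact h2

section Tight

/-- Tightness near `0` at the level of logarithms: going from `s / 4` to `s` costs at most
`3 / 2 * √s`, and these errors sum up to a geometric series. -/
lemma integral_log_add_le_quarter (hν : ∀ᵐ x ∂ν, x ∈ Set.Icc 0 K)
    (hb : ∀ t, 0 < t → 1 - measDensity ν t ≤ 1 / √t) {s : ℝ} (hs : 0 < s) :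
    ∫ x, Real.log (x + s) ∂ν - 3 * √s ≤
      ∫ x, Real.log (x + s / 4) ∂ν - 3 * √(s / 4) := by
  have hs4 : 0 < s / 4 := by positivity
  have hsq : √(s / 4) = √s / 2 := by
    rw [Real.sqrt_div hs.le, show (4 : ℝ) = 2 ^ 2 by norm_num, Real.sqrt_sq (by norm_num)]
  have hint : Integrable (fun x => 3 * (1 - x * (4 / s) / (1 + x * (4 / s)))) ν :=
    ((integrable_const _).sub (integrable_density hν (by positivity))).const_mul _
  have h1 : ∫ x, Real.log (x + s) ∂ν - ∫ x, Real.log (x + s / 4) ∂ν ≤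
      ∫ x, 3 * (1 - x * (4 / s) / (1 + x * (4 / s))) ∂ν := by
    rw [← integral_sub (integrable_log_add hν hs) (integrable_log_add hν hs4)]
    refine integral_mono_ae ((integrable_log_add hν hs).sub (integrable_log_add hν hs4)) hint
      (hν.mono fun x hx => ?_)
    have hx1 : 0 < x + s := by linarith [hx.1]
    have hx2 : 0 < x + s / 4 := by linarith [hx.1]
    dsimp only
    rw [← Real.log_div hx1.ne' hx2.ne']
    refine (Real.log_le_sub_one_of_pos (div_pos hx1 hx2)).trans (le_of_eq ?_)
    have : 0 < 1 + x * (4 / s) := one_add_mul_pos (by positivity) hx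
    have h' : x * (4 / s) / (1 + x * (4 / s)) = x / (x + s / 4) := by
      rw [div_eq_div_iff this.ne' hx2.ne']
      field_simp
      ring
    rw [h', div_sub_one hx2.ne', one_sub_div hx2.ne', ← mul_div_assoc]
    congr 1
    ring
  have h2 : ∫ x, 3 * (1 - x * (4 / s) / (1 + x * (4 / s))) ∂ν =
      3 * (1 - measDensity ν (4 / s)) := by
    rw [integral_const_mul, integral_sub (integrable_const _)
      (integrable_density hν (by positivity))]
    simp [measDensity]
  have h3 := hb (4 / s) (by positivity)
  have h4 : 1 / √(4 / s) = √s / 2 := by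
    rw [← hsq, one_div, ← Real.sqrt_inv, inv_div]
  rw [h4] at h3
  rw [hsq]
  linarith

lemma integral_log_add_le_pow (hν : ∀ᵐ x ∂ν, x ∈ Set.Icc 0 K)
    (hb : ∀ t, 0 < t → 1 - measDensity ν t ≤ 1 / √t) {s : ℝ} (hs : 0 < s) (n : ℕ) :
    ∫ x, Real.log (x + s) ∂ν - 3 * √s ≤ ∫ x, Real.log (x + s / 4 ^ n) ∂ν := by
  have : ∫ x, Real.log (x + s) ∂ν - 3 * √s ≤
      ∫ x, Real.log (x + s / 4 ^ n) ∂ν - 3 * √(s / 4 ^ n) := by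
    induction n with
    | zero => simp
    | succ n ih =>
      have h := integral_log_add_le_quarter hν hb (show 0 < s / 4 ^ n by positivity)
      rw [pow_succ, ← div_div]
      exact ih.trans h
  linarith [Real.sqrt_nonneg (s / 4 ^ n)]

lemma ae_pos_of_tight (hν : ∀ᵐ x ∂ν, x ∈ Set.Icc 0 K)
    (hb : ∀ t, 0 < t → 1 - measDensity ν t ≤ 1 / √t) : ∀ᵐ x ∂ν, 0 < x := by
  have h0 : ν.real {0} = 0 := by
    refine le_antisymm ?_ measureReal_nonneg
    have hlim : Tendsto (fun t : ℝ => 1 / √t) atTop (𝓝 0) := by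
      simpa [Function.comp_def] using (tendsto_inv_atTop_zero.comp Real.tendsto_sqrt_atTop)
    refine ge_of_tendsto hlim ?_
    filter_upwards [eventually_gt_atTop 0] with t ht
    refine le_trans ?_ (hb t ht)
    have h1 : 1 - measDensity ν t = ∫ x, (1 - x * t / (1 + x * t)) ∂ν := by
      rw [integral_sub (integrable_const _) (integrable_density hν ht.le)]
      simp [measDensity]
    have h2 : ν.real {0} = ∫ x, Set.indicator {0} (fun _ => (1 : ℝ)) x ∂ν := by
      rw [integral_indicator (measurableSet_singleton 0)]
      simp [Measure.real]
    rw [h1, h2]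
    refine integral_mono_ae ((integrable_const _).indicator (measurableSet_singleton 0))
      ((integrable_const _).sub (integrable_density hν ht.le)) (hν.mono fun x hx => ?_)
    by_cases hx0 : x = 0
    · simp [hx0]
    · rw [Set.indicator_of_notMem (by simpa using hx0)]
      exact sub_nonneg.2 (div_le_one_of_le₀ (by linarith) (one_add_mul_pos ht.le hx).le)
  have h1 : ∀ᵐ x ∂ν, x ≠ 0 := by
    rw [ae_iff]
    simpa [measureReal_eq_zero_iff] using h0
  filter_upwards [hν, h1] with x hx hx0
  exact lt_of_le_of_ne hx.1 hx0.symm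

/-- By Fatou's lemma, as `∫ ln (x + 4⁻ⁿ)` stays bounded below. -/
lemma integrable_log_of_tight (hν : ∀ᵐ x ∂ν, x ∈ Set.Icc 0 K)
    (hb : ∀ t, 0 < t → 1 - measDensity ν t ≤ 1 / √t) : Integrable Real.log ν := by
  have hpos := ae_pos_of_tight hν hb
  set C := Real.log (|K| + 1)
  have hC : 0 ≤ C := Real.log_nonneg (by linarith [abs_nonneg K])
  have hs : ∀ n : ℕ, (0 : ℝ) < 1 / 4 ^ n := fun n => by positivity
  have hle : ∀ n : ℕ, ∫ x, ‖Real.log (x + 1 / 4 ^ n)‖ ∂ν ≤ 2 * C + 3 := by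
    intro n
    have hn : (1 : ℝ) / 4 ^ n ≤ 1 := by
      rw [div_le_one (by positivity)]; exact one_le_pow₀ (by norm_num)
    have h1 : ∫ x, ‖Real.log (x + 1 / 4 ^ n)‖ ∂ν ≤ ∫ x, (2 * C - Real.log (x + 1 / 4 ^ n)) ∂ν := by
      refine integral_mono_ae (integrable_log_add hν (hs n)).norm
        ((integrable_const _).sub (integrable_log_add hν (hs n))) (hν.mono fun x hx => ?_)
      have : Real.log (x + 1 / 4 ^ n) ≤ C :=
        Real.log_le_log (by linarith [hx.1, hs n]) (by linarith [hx.2, le_abs_self K])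
      dsimp only
      rw [Real.norm_eq_abs, abs_le]
      constructor <;> linarith
    have h2 : ∫ x, (2 * C - Real.log (x + 1 / 4 ^ n)) ∂ν =
        2 * C - ∫ x, Real.log (x + 1 / 4 ^ n) ∂ν := by
      rw [integral_sub (integrable_const _) (integrable_log_add hν (hs n))]
      simp
    have h3 := integral_log_add_le_pow hν hb one_pos n
    have h4 : 0 ≤ ∫ x, Real.log (x + 1) ∂ν :=
      integral_nonneg_of_ae (hν.mono fun x hx => Real.log_nonneg (by linarith [hx.1]))
    rw [Real.sqrt_one] at h3
    linarith
  refine integrable_of_tendsto (G := fun n x => Real.log (x + 1 / 4 ^ n)) ?_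
    (fun n => (integrable_log_add hν (hs n)).aestronglyMeasurable) ?_
  · filter_upwards [hpos] with x hx
    have h1 : Tendsto (fun n : ℕ => x + 1 / (4 : ℝ) ^ n) atTop (𝓝 (x + 0)) := by
      refine tendsto_const_nhds.add ?_
      simpa [Function.comp_def] using tendsto_inv_atTop_zero.comp
        (tendsto_pow_atTop_atTop_of_one_lt (show (1 : ℝ) < 4 by norm_num))
    rw [add_zero] at h1
    exact (Real.continuousAt_log hx.ne').tendsto.comp h1
  · refine ((liminf_le_of_frequently_le' (Frequently.of_forall fun n => ?_)).trans_lt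
      (ENNReal.ofReal_lt_top (r := 2 * C + 3))).ne
    rw [← ofReal_integral_norm_eq_lintegral_enorm (integrable_log_add hν (hs n))]
    exact ENNReal.ofReal_le_ofReal (hle n)

lemma integral_log_add_le (hν : ∀ᵐ x ∂ν, x ∈ Set.Icc 0 K)
    (hb : ∀ t, 0 < t → 1 - measDensity ν t ≤ 1 / √t) {s : ℝ} (hs : 0 < s) :
    ∫ x, Real.log (x + s) ∂ν - 3 * √s ≤ ∫ x, Real.log x ∂ν := by
  have h1 : Tendsto (fun n : ℕ => s / (4 : ℝ) ^ n) atTop (𝓝[>] 0) := by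
    refine tendsto_nhdsWithin_iff.2 ⟨?_, Eventually.of_forall fun n => by
      simp only [Set.mem_Ioi]; positivity⟩
    simpa [div_eq_mul_inv] using (tendsto_inv_atTop_zero.comp
      (tendsto_pow_atTop_atTop_of_one_lt (show (1 : ℝ) < 4 by norm_num))).const_mul s
  exact ge_of_tendsto' ((tendsto_integral_log_add hν (ae_pos_of_tight hν hb)
    (integrable_log_of_tight hν hb)).comp h1) fun n => integral_log_add_le_pow hν hb hs n

lemma integral_log_le_add (hν : ∀ᵐ x ∂ν, x ∈ Set.Icc 0 K)
    (hb : ∀ t, 0 < t → 1 - measDensity ν t ≤ 1 / √t) {s : ℝ} (hs : 0 < s) :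
    ∫ x, Real.log x ∂ν ≤ ∫ x, Real.log (x + s) ∂ν :=
  integral_mono_ae (integrable_log_of_tight hν hb) (integrable_log_add hν hs)
    ((ae_pos_of_tight hν hb).mono fun _ hx => Real.log_le_log hx (by linarith))

/-- As `t → ∞`, writing `∫ ln (1 + x t) - p(t) ln t = ∫ ln (x + 1/t) + (1 - p(t)) ln t`
shows that the energy tends to half the integral of the logarithm. -/
lemma tendsto_measEnergy_atTop (hν : ∀ᵐ x ∂ν, x ∈ Set.Icc 0 K)
    (hb : ∀ t, 0 < t → 1 - measDensity ν t ≤ 1 / √t) :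
    Tendsto (measEnergy ν) atTop (𝓝 (1 / 2 * ∫ x, Real.log x ∂ν)) := by
  have hpos := ae_pos_of_tight hν hb
  have h1 : Tendsto (fun t : ℝ => ∫ x, Real.log (x + t⁻¹) ∂ν) atTop (𝓝 (∫ x, Real.log x ∂ν)) :=
    (tendsto_integral_log_add hν hpos (integrable_log_of_tight hν hb)).comp
      tendsto_inv_atTop_nhdsGT_zero
  have h2 : Tendsto (fun t : ℝ => (1 - measDensity ν t) * Real.log t) atTop (𝓝 0) := by
    have h3 : Tendsto (fun t : ℝ => 2 * (Real.log (√t) / √t)) atTop (𝓝 (2 * 0)) :=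
      (Real.isLittleO_log_id_atTop.tendsto_div_nhds_zero.comp Real.tendsto_sqrt_atTop).const_mul 2
    rw [mul_zero] at h3
    refine squeeze_zero' ?_ ?_ h3
    · filter_upwards [eventually_ge_atTop 1] with t ht
      exact mul_nonneg (sub_nonneg.2 (measDensity_le_one hν (by linarith))) (Real.log_nonneg ht)
    · filter_upwards [eventually_ge_atTop 1] with t ht
      have ht0 : 0 < t := by linarith
      calc (1 - measDensity ν t) * Real.log t ≤ 1 / √t * Real.log t :=
            mul_le_mul_of_nonneg_right (hb t ht0) (Real.log_nonneg ht)
        _ = 2 * (Real.log (√t) / √t) := by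
            rw [Real.log_sqrt ht0.le]; ring
  have h4 := (h1.add h2).const_mul (1 / 2)
  rw [add_zero] at h4
  refine h4.congr' ?_
  filter_upwards [eventually_gt_atTop 0] with t ht
  have h5 : ∫ x, Real.log (1 + x * t) ∂ν = ∫ x, (Real.log (x + t⁻¹) + Real.log t) ∂ν := by
    refine integral_congr_ae (hν.mono fun x hx => ?_)
    have : 0 < x + t⁻¹ := add_pos_of_nonneg_of_pos hx.1 (inv_pos.2 ht)
    dsimp only
    rw [← Real.log_mul this.ne' ht.ne']
    congr 1
    field_simp
    ring
  rw [measEnergy, h5, integral_add (integrable_log_add hν (inv_pos.2 ht)) (integrable_const _)]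
  simp
  ring

end Tight

end MeasureEntropy

/-! ### Limits of entropies -/

section EntropyLimit

variable {K : ℝ} {ν : ℕ → Measure ℝ} {ν' : Measure ℝ}

lemma tendsto_measDensity
    (h : ∀ f : ℝ → ℝ, ContinuousOn f (Set.Icc 0 K) →
      Tendsto (fun i => ∫ x, f x ∂(ν i)) atTop (𝓝 (∫ x, f x ∂ν')))
    {t : ℝ} (ht : 0 ≤ t) :
    Tendsto (fun i => measDensity (ν i) t) atTop (𝓝 (measDensity ν' t)) :=
  h _ (continuousOn_div_one_add (by fun_prop) ht)

variable [∀ i, IsProbabilityMeasure (ν i)] [IsProbabilityMeasure ν']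

/-- The inverse functions of the densities converge. -/
lemma tendsto_of_measDensity_eq (hν : ∀ i, ∀ᵐ x ∂(ν i), x ∈ Set.Icc 0 K)
    (hν' : ∀ᵐ x ∂ν', x ∈ Set.Icc 0 K) (hpos : ∀ᵐ x ∂ν', 0 < x)
    (h : ∀ f : ℝ → ℝ, ContinuousOn f (Set.Icc 0 K) →
      Tendsto (fun i => ∫ x, f x ∂(ν i)) atTop (𝓝 (∫ x, f x ∂ν')))
    {p : ℝ} {t : ℕ → ℝ} (ht : ∀ i, 0 ≤ t i ∧ measDensity (ν i) (t i) = p) {t' : ℝ}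
    (ht' : 0 ≤ t' ∧ measDensity ν' t' = p) : Tendsto t atTop (𝓝 t') := by
  rw [tendsto_order]
  constructor
  · intro a ha
    rcases lt_or_ge a 0 with ha0 | ha0
    · exact Eventually.of_forall fun i => ha0.trans_le (ht i).1
    · have h1 := measDensity_strictMono hν' hpos ha0 ha
      rw [ht'.2] at h1
      filter_upwards [(tendsto_measDensity h ha0).eventually_lt_const h1] with i hi
      by_contra! hle
      have := measDensity_mono (hν i) (ht i).1 hle
      rw [(ht i).2] at this
      exact absurd hi this.not_gt
  · intro a ha
    have ha0 := ht'.1.trans ha.le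
    have h1 := measDensity_strictMono hν' hpos ht'.1 ha
    rw [ht'.2] at h1
    filter_upwards [(tendsto_measDensity h ha0).eventually_const_lt h1] with i hi
    by_contra! hle
    have := measDensity_mono (hν i) ha0 hle
    rw [(ht i).2] at this
    exact absurd hi this.not_gt

lemma abs_log_one_add_sub_le {a b : ℝ} (ha : 0 ≤ a) (hb : 0 ≤ b) :
    |Real.log (1 + a) - Real.log (1 + b)| ≤ |a - b| := by
  have key : ∀ a b : ℝ, 0 ≤ a → 0 ≤ b → Real.log (1 + a) - Real.log (1 + b) ≤ |a - b| := by
    intro a b ha hb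
    have h1 : 0 < 1 + a := by linarith
    have h2 : 0 < 1 + b := by linarith
    rw [← Real.log_div h1.ne' h2.ne']
    refine (Real.log_le_sub_one_of_pos (div_pos h1 h2)).trans ?_
    rw [div_sub_one h2.ne', add_sub_add_left_eq_sub]
    calc (a - b) / (1 + b) ≤ |a - b| / (1 + b) := by gcongr; exact le_abs_self _
      _ ≤ |a - b| := div_le_self (abs_nonneg _) (by linarith)
  rw [abs_le]
  have h1 := key a b ha hb
  have h2 := key b a hb ha
  rw [abs_sub_comm] at h2
  constructor <;> linarith

lemma tendsto_measEnergy (hν : ∀ i, ∀ᵐ x ∂(ν i), x ∈ Set.Icc 0 K)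
    (hν' : ∀ᵐ x ∂ν', x ∈ Set.Icc 0 K) (hpos : ∀ᵐ x ∂ν', 0 < x)
    (h : ∀ f : ℝ → ℝ, ContinuousOn f (Set.Icc 0 K) →
      Tendsto (fun i => ∫ x, f x ∂(ν i)) atTop (𝓝 (∫ x, f x ∂ν')))
    {p : ℝ} {t : ℕ → ℝ} (ht : ∀ i, 0 ≤ t i ∧ measDensity (ν i) (t i) = p) {t' : ℝ}
    (ht' : 0 ≤ t' ∧ measDensity ν' t' = p) :
    Tendsto (fun i => measEnergy (ν i) (t i)) atTop (𝓝 (measEnergy ν' t')) := by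
  have htt := tendsto_of_measDensity_eq hν hν' hpos h ht ht'
  have h1 : Tendsto (fun i => ∫ x, Real.log (1 + x * t i) ∂(ν i)) atTop
      (𝓝 (∫ x, Real.log (1 + x * t') ∂ν')) := by
    have h2 := h (fun x => Real.log (1 + x * t')) (ContinuousOn.log (by fun_prop) fun _ hx =>
      (one_add_mul_pos ht'.1 hx).ne')
    have h3 : Tendsto (fun i => ∫ x, Real.log (1 + x * t i) ∂(ν i) -
        ∫ x, Real.log (1 + x * t') ∂(ν i)) atTop (𝓝 0) := by
      have h4 : Tendsto (fun i => K * |t i - t'|) atTop (𝓝 0) := by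
        simpa using ((htt.sub_const t').abs.const_mul K)
      refine squeeze_zero_norm (fun i => ?_) h4
      rw [← integral_sub (integrable_log_one_add_mul (hν i) (ht i).1)
        (integrable_log_one_add_mul (hν i) ht'.1)]
      have := norm_integral_le_of_norm_le_const (μ := ν i) (C := K * |t i - t'|)
        (f := fun x => Real.log (1 + x * t i) - Real.log (1 + x * t'))
        ((hν i).mono fun x hx => ?_)
      · simpa using this
      · refine (abs_log_one_add_sub_le (mul_nonneg hx.1 (ht i).1)
          (mul_nonneg hx.1 ht'.1)).trans ?_
        rw [← mul_sub, abs_mul, abs_of_nonneg hx.1]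
        exact mul_le_mul_of_nonneg_right hx.2 (abs_nonneg _)
    simpa using h3.add h2
  have h5 : Tendsto (fun i => p * Real.log (t i)) atTop (𝓝 (p * Real.log t')) := by
    -- for `t' = 0` the density vanishes, so that the logarithm does not enter
    rcases ht'.1.eq_or_lt with h0 | h0
    · have hp : p = 0 := by rw [← ht'.2, ← h0, measDensity_zero]
      simp [hp]
    · exact ((Real.continuousAt_log h0.ne').tendsto.comp htt).const_mul p
  have h6 := (h1.const_mul (1 / 2)).sub (h5.const_mul (1 / 2))
  have e : ∀ (m : Measure ℝ) (s : ℝ), measDensity m s = p → 1 / 2 * ∫ x, Real.log (1 + x * s) ∂m -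
      1 / 2 * (p * Real.log s) = measEnergy m s := by
    intro m s hs
    rw [measEnergy, hs]
    ring
  rw [e ν' t' ht'.2] at h6
  exact h6.congr fun i => e _ _ (ht i).2

/-- Under uniform tightness near `0`, the integrals of the logarithm converge. -/
lemma tendsto_integral_log (hν : ∀ i, ∀ᵐ x ∂(ν i), x ∈ Set.Icc 0 K)
    (hν' : ∀ᵐ x ∂ν', x ∈ Set.Icc 0 K)
    (h : ∀ f : ℝ → ℝ, ContinuousOn f (Set.Icc 0 K) →
      Tendsto (fun i => ∫ x, f x ∂(ν i)) atTop (𝓝 (∫ x, f x ∂ν')))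
    (hb : ∀ i t, 0 < t → 1 - measDensity (ν i) t ≤ 1 / √t)
    (hb' : ∀ t, 0 < t → 1 - measDensity ν' t ≤ 1 / √t) :
    Tendsto (fun i => ∫ x, Real.log x ∂(ν i)) atTop (𝓝 (∫ x, Real.log x ∂ν')) := by
  rw [Metric.tendsto_nhds]
  intro ε hε
  set s := (ε / 12) ^ 2 with hs
  have hs0 : 0 < s := by positivity
  have hsq : √s = ε / 12 := by rw [hs, Real.sqrt_sq (by positivity)]
  have hlim := h (fun x => Real.log (x + s)) (ContinuousOn.log (by fun_prop) fun x hx => by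
    have := hx.1; positivity)
  filter_upwards [Metric.tendsto_nhds.1 hlim (ε / 4) (by positivity)] with i hi
  have h1 := integral_log_add_le (hν i) (hb i) hs0
  have h2 := integral_log_le_add (hν i) (hb i) hs0
  have h3 := integral_log_add_le hν' hb' hs0
  have h4 := integral_log_le_add hν' hb' hs0
  rw [Real.dist_eq, abs_lt] at hi ⊢
  rw [hsq] at h1 h3
  constructor <;> linarith

end EntropyLimit

/-! ### Entropy of finite graphs -/

section FiniteGraphs

variable {V : Type} [Fintype V]

lemma freeEnergy_eq_measEnergy (hV : Even (Nat.card V)) (G : SimpleGraph V) {t : ℝ}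
    (ht : 0 ≤ t) : freeEnergy G t = measEnergy (gammaMeasure G) t := by
  rw [freeEnergy, log_genPoly_eq_integral hV G ht, measEnergy, measDensity,
    density_eq_integral hV G ht]

lemma ae_gammaMeasure_mem_Icc {G : SimpleGraph V} {D : ℕ}
    (hD : ∀ v, (G.neighborSet v).ncard ≤ D) :
    ∀ᵐ x ∂(gammaMeasure G), x ∈ Set.Icc (0 : ℝ) (4 * D) :=
  ae_gammaMeasure fun _ hx => ⟨gammas_nonneg hx, gammas_le hD hx⟩

lemma exists_ae_gammaMeasure_mem_Icc (G : SimpleGraph V) :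
    ∃ K : ℝ, ∀ᵐ x ∂(gammaMeasure G), x ∈ Set.Icc (0 : ℝ) K :=
  ⟨_, ae_gammaMeasure_mem_Icc (D := Nat.card V) fun _ => Set.ncard_le_card _⟩

variable [Nonempty V]

lemma activity_spec (hV : Even (Nat.card V)) {G : SimpleGraph V} (hG : 0 < prm G) {p : ℝ}
    (hp0 : 0 ≤ p) (hp1 : p < 1) :
    0 ≤ activity G p ∧ measDensity (gammaMeasure G) (activity G p) = p := by
  have := isProbabilityMeasure_gammaMeasure hV G
  obtain ⟨K, hK⟩ := exists_ae_gammaMeasure_mem_Icc G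
  obtain ⟨t, ht, htp⟩ := exists_measDensity_eq hK
    (ae_gammaMeasure fun _ hx => gammas_pos hV hG hx) hp0 hp1
  have hex : ∃ t ∈ Set.Ici (0 : ℝ), density G t = p :=
    ⟨t, ht, by rw [density_eq_integral hV G ht]; exact htp⟩
  have h1 : 0 ≤ activity G p := Function.invFunOn_mem hex
  refine ⟨h1, ?_⟩
  have h2 : density G (activity G p) = p := Function.invFunOn_eq hex
  rwa [density_eq_integral hV G h1] at h2

lemma entropy_of_lt_one (hV : Even (Nat.card V)) {G : SimpleGraph V} (hG : 0 < prm G) {p : ℝ}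
    (hp0 : 0 ≤ p) (hp1 : p < 1) :
    entropy G p = measEnergy (gammaMeasure G) (activity G p) := by
  rw [entropy, pStar_eq_one hV hG, if_pos hp1,
    freeEnergy_eq_measEnergy hV G (activity_spec hV hG hp0 hp1).1]

lemma entropy_one (hV : Even (Nat.card V)) {G : SimpleGraph V} (hG : 0 < prm G)
    (hb : ∀ t, 0 < t → 1 - measDensity (gammaMeasure G) t ≤ 1 / √t) :
    entropy G 1 = Real.log (prm G) / Nat.card V := by
  have := isProbabilityMeasure_gammaMeasure hV G
  obtain ⟨K, hK⟩ := exists_ae_gammaMeasure_mem_Icc G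
  rw [entropy, pStar_eq_one hV hG, if_neg (lt_irrefl _), if_pos rfl, log_prm_eq_integral hV hG]
  refine Tendsto.limUnder_eq ?_
  have h1 := (tendsto_measEnergy_atTop hK hb).comp (tendsto_atTop_of_measDensity_eq hK
    (ae_gammaMeasure fun _ hx => gammas_pos hV hG hx) fun p hp0 hp1 =>
      activity_spec hV hG hp0 hp1)
  refine h1.congr' ?_
  filter_upwards [Ioo_mem_nhdsLT (zero_lt_one (α := ℝ))] with q hq
  exact (freeEnergy_eq_measEnergy hV G (activity_spec hV hG hq.1.le hq.2).1).symm

end FiniteGraphs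

/-! ### Vertex-transitive bipartite graphs -/

section VertexTransitive

variable {V : Type} [Fintype V]

lemma uncovered_univ_eq {G : SimpleGraph V} (hG : VertexTransitive G) (u v : V) (t : ℝ) :
    uncovered G Finset.univ u t = uncovered G Finset.univ v t := by
  obtain ⟨φ, hφ⟩ := hG u v
  have h := matchSum_map (G := G) (G' := G) φ.toEquiv.toEmbedding (Finset.univ.erase u)
    (fun a _ b _ => φ.map_adj_iff) t
  rw [Finset.map_erase, Finset.map_univ_equiv] at h
  rw [uncovered, uncovered, ← h, ← hφ]
  rfl

variable [Nonempty V]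

/-- The key estimate. All vertices are uncovered with the same probability `a = 1 - p(G,t)`. By
positive correlation, both ends of an edge are uncovered with probability at least `a ^ 2`, and
adding the edge shows that this probability is at most `1 / t`. -/
lemma one_sub_density_le {G : SimpleGraph V} (htr : VertexTransitive G) (hbip : G.IsBipartite)
    {u v : V} (huv : G.Adj u v) {t : ℝ} (ht : 0 < t) : 1 - density G t ≤ 1 / √t := by
  obtain ⟨c⟩ := hbip
  have hV : (Nat.card V : ℝ) ≠ 0 := by exact_mod_cast Nat.card_pos.ne'
  have h1 : 1 - density G t = uncovered G Finset.univ u t := by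
    rw [density_eq G ht.le, Finset.sum_congr rfl fun w _ => uncovered_univ_eq htr w u t,
      Finset.sum_const, Finset.card_univ, ← Nat.card_eq_fintype_card, nsmul_eq_mul]
    field_simp
    ring
  set a := uncovered G Finset.univ u t with ha
  have hav : a = uncovered G Finset.univ v t := uncovered_univ_eq htr u v t
  set W := matchSum G Finset.univ t
  have hW : 0 < W := matchSum_pos G _ ht.le
  have h2 := (matchSum_correlation c ht.le Finset.univ u (by simp) v (by simp)
    (G.ne_of_adj huv)).1 (c.valid huv)
  have h3 : matchSum G (Finset.univ.erase u) t = a * W := by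
    rw [ha, uncovered, div_mul_cancel₀ _ hW.ne']
  have h4 : matchSum G (Finset.univ.erase v) t = a * W := by
    rw [hav, uncovered, div_mul_cancel₀ _ hW.ne']
  have h5 : t * matchSum G ((Finset.univ.erase u).erase v) t ≤ W := by
    have h6 := matchSum_rec G (Finset.mem_univ u) t
    have h7 := Finset.single_le_sum (f := fun w => matchSum G ((Finset.univ.erase u).erase w) t)
      (fun w _ => (matchSum_pos G _ ht.le).le)
      (Finset.mem_filter.2 ⟨Finset.mem_univ v, huv⟩ : v ∈ Finset.univ.filter (G.Adj u))
    have h8 := mul_le_mul_of_nonneg_left h7 ht.le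
    have h9 := (matchSum_pos G (Finset.univ.erase u) ht.le).le
    linarith
  rw [h3, h4] at h2
  have h6 : t * a ^ 2 ≤ 1 := by
    have : (t * a ^ 2) * (W * W) ≤ 1 * (W * W) := by
      calc (t * a ^ 2) * (W * W) = t * (a * W * (a * W)) := by ring
        _ ≤ t * (W * matchSum G ((Finset.univ.erase u).erase v) t) := by gcongr
        _ = W * (t * matchSum G ((Finset.univ.erase u).erase v) t) := by ring
        _ ≤ W * W := by gcongr
        _ = 1 * (W * W) := by ring
    exact le_of_mul_le_mul_right this (mul_pos hW hW)
  rw [h1, one_div, ← Real.sqrt_inv]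
  refine Real.le_sqrt_of_sq_le ?_
  rw [← one_div, le_div_iff₀ ht]
  linarith

/-- A perfect matching exists since otherwise a positive proportion of the vertices would stay
uncovered for all `t`. -/
lemma even_and_prm_pos_of_tight {G : SimpleGraph V}
    (hb : ∀ t, 0 < t → 1 - density G t ≤ 1 / √t) : Even (Nat.card V) ∧ 0 < prm G := by
  have hV : (0 : ℝ) < Nat.card V := by exact_mod_cast Nat.card_pos
  obtain ⟨E, hE, hcard⟩ : ∃ E ∈ matchingsIn G Finset.univ, 2 * E.card = Nat.card V := by
    by_contra! hcon
    -- then the uncovered proportion is at least `1 / v(G)`, but at this `t` at most `1 / (2 v(G))`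
    set t : ℝ := (2 * Nat.card V) ^ 2 with ht
    have ht0 : 0 < t := by positivity
    have hW := matchSum_pos G Finset.univ ht0.le
    have h1 := hb t ht0
    rw [density_eq G ht0.le, sub_sub_cancel, ht, Real.sqrt_sq (by positivity), ← ht] at h1
    simp only [uncovered] at h1
    rw [← Finset.sum_div, sum_matchSum_erase, div_div, div_le_div_iff₀ (by positivity)
      (by positivity)] at h1
    have h2 : matchSum G Finset.univ t ≤ ∑ E ∈ matchingsIn G Finset.univ,
        (((Finset.univ : Finset V).card : ℝ) - 2 * (E.card : ℝ)) * t ^ E.card := by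
      refine Finset.sum_le_sum fun E hE => ?_
      have h3 := two_mul_card_le hE
      have h4 : 2 * E.card + 1 ≤ (Finset.univ : Finset V).card := by
        rw [Finset.card_univ, ← Nat.card_eq_fintype_card]
        have := hcon E hE
        omega
      have h5 : (2 * (E.card : ℝ) + 1) ≤ ((Finset.univ : Finset V).card : ℝ) := by
        exact_mod_cast h4
      have h6 : 0 ≤ t ^ E.card := by positivity
      nlinarith
    nlinarith [mul_le_mul_of_nonneg_right h2 hV.le, mul_pos hW hV]
  have hV2 : Even (Nat.card V) := ⟨E.card, by omega⟩
  refine ⟨hV2, ?_⟩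
  rw [← numMatchings_half_eq_prm hV2, numMatchings_eq_card, Finset.card_pos]
  exact ⟨E, Finset.mem_filter.2 ⟨hE, by omega⟩⟩

end VertexTransitive

/-! ### Convergence of the root measures -/

section Convergence

/-- Graphs of bounded degree with asymptotically equal ball frequencies have asymptotically equal
root measures. -/
lemma asympEq_gammaMeasure {ι : Type*} {l : Filter ι} {V W : ι → Type} [∀ i, Fintype (V i)]
    [∀ i, Nonempty (V i)] [∀ i, Fintype (W i)] [∀ i, Nonempty (W i)]
    {G : ∀ i, SimpleGraph (V i)} {H : ∀ i, SimpleGraph (W i)} {D : ℕ}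
    (hG : ∀ i v, ((G i).neighborSet v).ncard ≤ D) (hH : ∀ i v, ((H i).neighborSet v).ncard ≤ D)
    (hV : ∀ i, Even (Nat.card (V i))) (hW : ∀ i, Even (Nat.card (W i)))
    (hGH : ∀ (α : RootedGraph) (r : ℕ), Finite α.V → 0 < r →
      Tendsto (fun i => ballProb (G i) α r - ballProb (H i) α r) l (𝓝 0))
    {f : ℝ → ℝ} (hf : ContinuousOn f (Set.Icc (0 : ℝ) (4 * D))) :
    Tendsto (fun i => ∫ x, f x ∂(gammaMeasure (G i)) - ∫ x, f x ∂(gammaMeasure (H i))) l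
      (𝓝 0) := by
  have _ := fun i => isProbabilityMeasure_gammaMeasure (hV i) (G i)
  have _ := fun i => isProbabilityMeasure_gammaMeasure (hW i) (H i)
  refine (AsympEq.of_density (fun i => ae_gammaMeasure_mem_Icc (hG i))
    (fun i => ae_gammaMeasure_mem_Icc (hH i)) (δ := 1 / (2 * (D + 1))) (by positivity)
    (fun t ht htδ => ?_) hf).2
  have htD : t * D ≤ 1 / 2 := by
    calc t * D ≤ 1 / (2 * (D + 1)) * (D + 1) := by
          gcongr
          linarith
      _ = 1 / 2 := by field_simp
  refine (tendsto_density_sub hG hH hGH ht.le htD).congr fun i => ?_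
  rw [density_eq_integral (hV i) (G i) ht.le, density_eq_integral (hW i) (H i) ht.le]

/-- The symmetric measure on the line whose image under squaring is `ν`: the mean of the images
of `ν` under `√` and `-√`. -/
def symmSqrt (ν : Measure ℝ) : Measure ℝ :=
  (2⁻¹ : ℝ≥0∞) • (ν.map Real.sqrt + ν.map fun x => -√x)

lemma isProbabilityMeasure_symmSqrt (ν : Measure ℝ) [IsProbabilityMeasure ν] :
    IsProbabilityMeasure (symmSqrt ν) := by
  constructor
  have h1 : (ν.map Real.sqrt) Set.univ = 1 := by
    rw [Measure.map_apply (by fun_prop) MeasurableSet.univ]; simp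
  have h2 : (ν.map fun x => -√x) Set.univ = 1 := by
    rw [Measure.map_apply (by fun_prop) MeasurableSet.univ]; simp
  rw [symmSqrt, Measure.smul_apply, Measure.add_apply, h1, h2, smul_eq_mul, one_add_one_eq_two]
  exact ENNReal.inv_mul_cancel (by norm_num) (by norm_num)

lemma map_sq_symmSqrt {ν : Measure ℝ} (hν : ∀ᵐ x ∂ν, 0 ≤ x) :
    (symmSqrt ν).map (fun z => z ^ 2) = ν := by
  have key : ∀ g : ℝ → ℝ, Measurable g → (∀ x, 0 ≤ x → g x ^ 2 = x) →
      (ν.map g).map (fun z => z ^ 2) = ν := by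
    intro g hg h
    rw [Measure.map_map (by fun_prop) hg]
    have : (fun z : ℝ => z ^ 2) ∘ g =ᵐ[ν] id := hν.mono fun x hx => h x hx
    rw [Measure.map_congr this, Measure.map_id]
  rw [symmSqrt, Measure.map_smul, Measure.map_add _ _ (by fun_prop),
    key _ (by fun_prop) fun x hx => Real.sq_sqrt hx,
    key _ (by fun_prop) fun x hx => by rw [neg_sq, Real.sq_sqrt hx], ← two_smul ℝ≥0∞ ν,
    smul_smul, ENNReal.inv_mul_cancel (by norm_num) (by norm_num), one_smul]

lemma integral_symmSqrt {ν : Measure ℝ} [IsProbabilityMeasure ν] (f : ℝ →ᵇ ℝ) :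
    ∫ x, f x ∂(symmSqrt ν) = ∫ x, (f (√x) + f (-√x)) / 2 ∂ν := by
  have h1 : IsProbabilityMeasure (ν.map Real.sqrt) := Measure.isProbabilityMeasure_map (by fun_prop)
  have h2 : IsProbabilityMeasure (ν.map fun x => -√x) :=
    Measure.isProbabilityMeasure_map (by fun_prop)
  have i1 : Integrable (fun x => f (√x)) ν :=
    (f.integrable (ν.map Real.sqrt)).comp_measurable (by fun_prop)
  have i2 : Integrable (fun x => f (-√x)) ν :=
    (f.integrable (ν.map fun x => -√x)).comp_measurable (by fun_prop)
  rw [symmSqrt, integral_smul_measure, integral_add_measure (f.integrable _) (f.integrable _),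
    integral_map (by fun_prop) f.continuous.aestronglyMeasurable,
    integral_map (by fun_prop) f.continuous.aestronglyMeasurable, integral_div,
    integral_add i1 i2]
  simp
  ring

end Convergence

/-! ### The entropy of the limit -/

section Limit

/-- The activity at density `p` for a measure `ν` on `[0,∞)` without an atom at `0`; the inverse
function of `measDensity ν` on `[0,1)`. -/
def measActivity (ν : Measure ℝ) (p : ℝ) : ℝ :=
  Function.invFunOn (measDensity ν) (Set.Ici 0) p

/-- The entropy function of a measure on `[0,1]`, with its limit value at `1`. -/
def measEntropy (ν : Measure ℝ) (p : ℝ) : ℝ :=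
  if p < 1 then measEnergy ν (measActivity ν p) else 1 / 2 * ∫ x, Real.log x ∂ν

lemma measActivity_spec {ν : Measure ℝ} [IsProbabilityMeasure ν] {K : ℝ}
    (hν : ∀ᵐ x ∂ν, x ∈ Set.Icc 0 K) (hpos : ∀ᵐ x ∂ν, 0 < x) {p : ℝ} (hp0 : 0 ≤ p) (hp1 : p < 1) :
    0 ≤ measActivity ν p ∧ measDensity ν (measActivity ν p) = p := by
  have hex : ∃ t ∈ Set.Ici (0 : ℝ), measDensity ν t = p := exists_measDensity_eq hν hpos hp0 hp1
  exact ⟨Function.invFunOn_mem hex, Function.invFunOn_eq hex⟩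

lemma tendsto_measEntropy_left {ν : Measure ℝ} [IsProbabilityMeasure ν] {K : ℝ}
    (hν : ∀ᵐ x ∂ν, x ∈ Set.Icc 0 K) (hb : ∀ t, 0 < t → 1 - measDensity ν t ≤ 1 / √t) :
    Tendsto (measEntropy ν) (𝓝[<] 1) (𝓝 (measEntropy ν 1)) := by
  rw [measEntropy, if_neg (lt_irrefl _)]
  refine ((tendsto_measEnergy_atTop hν hb).comp (tendsto_atTop_of_measDensity_eq hν
    (ae_pos_of_tight hν hb) fun p hp0 hp1 =>
      measActivity_spec hν (ae_pos_of_tight hν hb) hp0 hp1)).congr' ?_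
  filter_upwards [self_mem_nhdsWithin] with p hp
  rw [measEntropy, if_pos (Set.mem_Iio.1 hp), Function.comp_apply]

/-- If the root measures of `G i` converge to `ν`, then the entropies of all graphs `H i` with
perfect matchings and asymptotically the same ball frequencies converge to the entropy of `ν`. -/
lemma tendsto_entropy {V W : ℕ → Type} [∀ i, Fintype (V i)] [∀ i, Nonempty (V i)]
    [∀ i, Fintype (W i)] [∀ i, Nonempty (W i)] {G : ∀ i, SimpleGraph (V i)}
    {H : ∀ i, SimpleGraph (W i)} {D : ℕ} (hG : ∀ i v, ((G i).neighborSet v).ncard ≤ D)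
    (hH : ∀ i v, ((H i).neighborSet v).ncard ≤ D) (hV : ∀ i, Even (Nat.card (V i)))
    (hW : ∀ i, Even (Nat.card (W i))) (hWprm : ∀ i, 0 < prm (H i))
    (hGH : ∀ (α : RootedGraph) (r : ℕ), Finite α.V → 0 < r →
      Tendsto (fun i => ballProb (G i) α r - ballProb (H i) α r) atTop (𝓝 0))
    {ν : Measure ℝ} [IsProbabilityMeasure ν] (hν : ∀ᵐ x ∂ν, x ∈ Set.Icc (0 : ℝ) (4 * D))
    (hpos : ∀ᵐ x ∂ν, 0 < x) (hlim : WeakConv (fun i => gammaMeasure (G i)) ν)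
    {p : ℝ} (hp0 : 0 ≤ p) (hp1 : p < 1) :
    Tendsto (fun i => entropy (H i) p) atTop (𝓝 (measEntropy ν p)) := by
  have _ := fun i => isProbabilityMeasure_gammaMeasure (hW i) (H i)
  have hconv : ∀ f : ℝ → ℝ, ContinuousOn f (Set.Icc (0 : ℝ) (4 * D)) →
      Tendsto (fun i => ∫ x, f x ∂(gammaMeasure (H i))) atTop (𝓝 (∫ x, f x ∂ν)) := by
    intro f hf
    have h1 := hlim.tendsto_integral (by positivity) (fun i => ae_gammaMeasure_mem_Icc (hG i)) hν hf
    simpa using h1.sub (asympEq_gammaMeasure hG hH hV hW hGH hf)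
  rw [measEntropy, if_pos hp1]
  exact (tendsto_measEnergy (fun i => ae_gammaMeasure_mem_Icc (hH i)) hν hpos hconv
    (fun i => activity_spec (hW i) (hWprm i) hp0 hp1)
    (measActivity_spec hν hpos hp0 hp1)).congr fun i =>
      (entropy_of_lt_one (hW i) (hWprm i) hp0 hp1).symm

lemma weakConv_matchingMeasure {V : ℕ → Type} [∀ i, Fintype (V i)] {G : ∀ i, SimpleGraph (V i)}
    (hV : ∀ i, Even (Nat.card (V i))) {ν : Measure ℝ} [IsProbabilityMeasure ν]
    (h : WeakConv (fun i => gammaMeasure (G i)) ν) :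
    WeakConv (fun i => matchingMeasure (G i)) (symmSqrt ν) := by
  intro f
  let g : ℝ →ᵇ ℝ := (1 / 2 : ℝ) • (f.compContinuous ⟨fun x => √x, by fun_prop⟩ +
    f.compContinuous ⟨fun x => -√x, by fun_prop⟩)
  have hg : ∀ x, g x = (f (√x) + f (-√x)) / 2 := fun x => by simp [g]; ring
  have := h g
  simp only [hg] at this
  rw [integral_symmSqrt]
  exact this.congr fun i => (integral_matchingMeasure (hV i) (G i) f).symm

end Limit

end MatchEnt

end

theorem mainTheorem2 (d : ℕ) (hd : 1 ≤ d) {V : ℕ → Type}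
    [∀ i, Finite (V i)] [∀ i, Nonempty (V i)]
    (G : ∀ i, SimpleGraph (V i)) [∀ i, (G i).LocallyFinite]
    (hreg : ∀ i, (G i).IsRegularOfDegree d)
    (hbip : ∀ i, (G i).IsBipartite)
    (htrans : ∀ i, MatchEnt.VertexTransitive (G i))
    (hconv : MatchEnt.BSConvergent G) :
    (∀ i, 0 < MatchEnt.prm (G i) ∧
      MatchEnt.entropy (G i) 1
        = Real.log (MatchEnt.prm (G i) : ℝ) / (Nat.card (V i) : ℝ)) ∧
    ∃ ρ ρbar : Measure ℝ, IsProbabilityMeasure ρ ∧ IsProbabilityMeasure ρbar ∧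
      MatchEnt.WeakConv (fun i => MatchEnt.matchingMeasure (G i)) ρ ∧
      MatchEnt.WeakConv (fun i => MatchEnt.gammaMeasure (G i)) ρbar ∧
      ρbar = ρ.map (fun z : ℝ => z ^ 2) ∧
      ρbar {0} = 0 ∧ Integrable Real.log ρbar ∧
      Tendsto (fun i => Real.log (MatchEnt.prm (G i) : ℝ) / (Nat.card (V i) : ℝ)) atTop
        (𝓝 (1 / 2 * ∫ x, Real.log x ∂ρbar)) ∧
      ∀ (L : Measure MatchEnt.RootedGraph) [IsProbabilityMeasure L],
        MatchEnt.BSConvergesTo G L →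
          ∃ lam : ℝ → ℝ, MatchEnt.IsEntropyOf L 1 lam ∧
            Tendsto (fun i => MatchEnt.entropy (G i) 1) atTop (𝓝 (lam 1)) ∧
            lam 1 = 1 / 2 * ∫ x, Real.log x ∂ρbar := by
  open MatchEnt in
  have _ : ∀ i, Fintype (V i) := fun i => Fintype.ofFinite _
  obtain ⟨⟨D, hD⟩, hball⟩ := hconv
  have hdens : ∀ i t, 0 < t → 1 - density (G i) t ≤ 1 / √t := by
    intro i t ht
    obtain ⟨u⟩ := ‹∀ i, Nonempty (V i)› i
    have hdeg : 0 < (G i).degree u := by rw [hreg i u]; exact hd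
    obtain ⟨v, huv⟩ := ((G i).degree_pos_iff_exists_adj u).1 hdeg
    exact one_sub_density_le (htrans i) (hbip i) huv ht
  have hprm : ∀ i, Even (Nat.card (V i)) ∧ 0 < prm (G i) := fun i =>
    even_and_prm_pos_of_tight (hdens i)
  have hV := fun i => (hprm i).1
  have hb : ∀ i t, 0 < t → 1 - measDensity (gammaMeasure (G i)) t ≤ 1 / √t := fun i t ht => by
    have := hdens i t ht
    rwa [density_eq_integral (hV i) (G i) ht.le] at this
  have hent : ∀ i, entropy (G i) 1 = Real.log (prm (G i)) / Nat.card (V i) := fun i =>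
    entropy_one (hV i) (hprm i).2 (hb i)
  refine ⟨fun i => ⟨(hprm i).2, hent i⟩, ?_⟩
  have hprob := fun i => isProbabilityMeasure_gammaMeasure (hV i) (G i)
  have hsupp := fun i => ae_gammaMeasure_mem_Icc (hD i)
  -- compare the sequence with itself at two indices to see that the integrals are Cauchy
  obtain ⟨ν, hνprob, hν, hlim⟩ := exists_weakConv hsupp fun f =>
    asympEq_gammaMeasure (G := fun p : ℕ × ℕ => G p.1) (H := fun p : ℕ × ℕ => G p.2)
      (l := atTop ×ˢ atTop) (fun p => hD p.1) (fun p => hD p.2) (fun p => hV p.1)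
      (fun p => hV p.2) (fun α r hα hr => by
        obtain ⟨c, hc⟩ := hball α r hα hr
        simpa using (hc.comp tendsto_fst).sub (hc.comp tendsto_snd)) f.continuous.continuousOn
  have hconv : ∀ f : ℝ → ℝ, ContinuousOn f (Set.Icc (0 : ℝ) (4 * D)) →
      Tendsto (fun i => ∫ x, f x ∂(gammaMeasure (G i))) atTop (𝓝 (∫ x, f x ∂ν)) :=
    fun f hf => hlim.tendsto_integral (by positivity) hsupp hν hf
  have hbν : ∀ t, 0 < t → 1 - measDensity ν t ≤ 1 / √t := fun t ht =>
    le_of_tendsto' ((tendsto_measDensity hconv ht.le).const_sub 1) fun i => hb i t ht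
  have hpos := ae_pos_of_tight hν hbν
  have hlog : Tendsto (fun i => Real.log (prm (G i) : ℝ) / (Nat.card (V i) : ℝ)) atTop
      (𝓝 (1 / 2 * ∫ x, Real.log x ∂ν)) :=
    ((tendsto_integral_log hsupp hν hconv hb hbν).const_mul (1 / 2)).congr fun i =>
      (log_prm_eq_integral (hV i) (hprm i).2).symm
  refine ⟨symmSqrt ν, ν, isProbabilityMeasure_symmSqrt ν, hνprob, weakConv_matchingMeasure hV hlim,
    hlim, (map_sq_symmSqrt (hν.mono fun x hx => hx.1)).symm, ?_, integrable_log_of_tight hν hbν,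
    hlog, fun L _ hL => ⟨measEntropy ν, ⟨⟨V, G, inferInstance, inferInstance, hL, fun i =>
      (pStar_eq_one (hV i) (hprm i).2).ge⟩, ?_, tendsto_measEntropy_left hν hbν⟩, ?_, ?_⟩⟩
  · have h0 : ∀ᵐ x ∂ν, x ≠ 0 := hpos.mono fun x hx => hx.ne'
    simpa [ae_iff] using h0
  · intro W H hH p hp0 hp1
    have _ := hH.finite
    have _ := hH.nonempty
    have _ : ∀ i, Fintype (W i) := fun i => Fintype.ofFinite _
    obtain ⟨D', hD'⟩ := hH.converges.1
    have hW := fun i => even_and_prm_pos_of_one_le_pStar (hH.le_pStar i)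
    refine tendsto_entropy (D := max D D') (fun i v => (hD i v).trans (le_max_left _ _))
      (fun i v => (hD' i v).trans (le_max_right _ _)) hV (fun i => (hW i).1) (fun i => (hW i).2)
      (fun α r hα hr => ?_) (hν.mono fun x hx => ⟨hx.1, hx.2.trans ?_⟩) hpos hlim hp0 hp1
    · simpa using (hL.2 α r hα hr).sub (hH.converges.2 α r hα hr)
    · have : (D : ℝ) ≤ (max D D' : ℕ) := by exact_mod_cast le_max_left D D'
      linarith
  · rw [measEntropy, if_neg (lt_irrefl _)]
    exact hlog.congr fun i => (hent i).symm
  · rw [measEntropy, if_neg (lt_irrefl _)]
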